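/- Let $\Gamma=(V,E)$ be a finite metric graph with at least one edge: every edge $e\in E$ is an interval $[0,\ell_e]$ with $0<\ell_e<\infty$, the endpoints of the edges are partitioned into nonempty classes, which are the vertices $v\in V$, and $\Gamma$ is obtained by gluing the endpoints in each class (loops, multiple edges and disconnected graphs are allowed). Write $L(\Gamma)=\sum_{e\in E}\ell_e$ and $\ell_{\min}=\min_{e\in E}\ell_e$. Let $p\in[1,\infty]$, let $q\in L^p(\Gamma)$ be real-valued with positive part $q_+=\max(q,0)$, and let $\alpha_v\in\mathbb R\cup\{\infty\}$ for $v\in V$ be arbitrary coupling strengths. Consider the eigenvalue problem for the Schrödinger operator $H_q=-\frac{d^2}{dx^2}+q$ on $\Gamma$, $$ \begin{cases} -f''+qf=\lambda f &\text{a.e. on every edge},\\ f\text{ is continuous}&\text{on }\Gamma,\\ \sum_{e\in E_v}f_e'(v)=\alpha_v f(v)&\text{at every } v\in V\text{ with }\alpha_v\in\mathbb R,\\ f(v)=0&\text{at every } v\in V\text{ with }\alpha_v=\infty, \end{cases} $$ for real-valued $f$ that is differentiable on every closed edge with absolutely continuous derivative $f'$; here $E_v$ is the set of edge ends at $v$ (a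 loop counts twice) and $f_e'(v)$ is the derivative of $f$ at $v$ in the direction pointing out of $v$ into $e$. Then the eigenvalues, repeated according to multiplicity, form a sequence $\lambda_1(H_q)\le\lambda_2(H_q)\le\lambda_3(H_q)\le\cdots\nearrow\infty$, and for every integer $k\ge 1$ $$ \lambda_k(H_q)\le\left(\frac{2k}{\ell_{\min}}\right)^{1/p}\|q_+\|_{L^p(\Gamma)}+\frac{\pi^2}{L(\Gamma)^2}\,(k-1+|E|)^2, $$ where $1/p=0$ if $p=\infty$. -/

import Mathlib

open MeasureTheory Set Filter Topology

/-- A finite metric graph with vertex set `V` and edge set `E`: every edge `e` is an interval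
`[0, length e]` of positive length.  An edge end is a pair `(e, b)`, where `b = false` stands for
the end `0` and `b = true` for the end `length e`; the edge ends are partitioned into the
(nonempty) classes indexed by `V`.  Loops, multiple edges and several connected components are
allowed. -/
structure MetricGraph (V E : Type*) where
  length : E → ℝ
  length_pos : ∀ e, 0 < length e
  vertexOf : E × Bool → V
  vertexOf_surjective : Function.Surjective vertexOf

namespace MetricGraph

variable {V E : Type*} (Γ : MetricGraph V E)

/-- The disjoint union of the closed intervals `[0, length e]`. -/
abbrev EdgeUnion : Type _ := Σ e : E, Icc (0 : ℝ) (Γ.length e)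

/-- The end of an edge, as a point of the disjoint union of the edges. -/
def endOf : E × Bool → Γ.EdgeUnion
  | (e, false) => ⟨e, 0, le_rfl, (Γ.length_pos e).le⟩
  | (e, true) => ⟨e, Γ.length e, (Γ.length_pos e).le, le_rfl⟩

/-- Two edge ends are glued when they belong to the same vertex. -/
def Glue (x y : Γ.EdgeUnion) : Prop :=
  ∃ s t : E × Bool, Γ.vertexOf s = Γ.vertexOf t ∧ x = Γ.endOf s ∧ y = Γ.endOf t

/-- The metric graph as a space: the quotient of the disjoint union of the edges. -/
def Point : Type _ := Quot Γ.Glue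

instance : TopologicalSpace Γ.Point := inferInstanceAs (TopologicalSpace (Quot Γ.Glue))

instance : MeasurableSpace Γ.Point := inferInstanceAs (MeasurableSpace (Quot Γ.Glue))

/-- The parametrisation of the edge `e` by `[0, length e]`
(extended to `ℝ` by projecting to the interval). -/
noncomputable def edge (e : E) (x : ℝ) : Γ.Point :=
  Quot.mk _ ⟨e, projIcc 0 (Γ.length e) (Γ.length_pos e).le x⟩

/-- The vertex `v`, as a point of the metric graph. -/
noncomputable def vertex (v : V) : Γ.Point :=
  Quot.mk _ (Γ.endOf (Function.surjInv Γ.vertexOf_surjective v))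

theorem mk_endOf (s : E × Bool) :
    (Quot.mk _ (Γ.endOf s) : Γ.Point) = Γ.vertex (Γ.vertexOf s) :=
  Quot.sound ⟨s, _, (Function.surjInv_eq Γ.vertexOf_surjective _).symm, rfl, rfl⟩

theorem edge_zero (e : E) : Γ.edge e 0 = Γ.vertex (Γ.vertexOf (e, false)) := by
  rw [← mk_endOf]
  simp [edge, endOf, projIcc_left]
  rfl

theorem edge_length (e : E) :
    Γ.edge e (Γ.length e) = Γ.vertex (Γ.vertexOf (e, true)) := by
  rw [← mk_endOf]
  simp [edge, endOf, projIcc_right]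
  rfl

theorem measurable_edge (e : E) : Measurable (Γ.edge e) := by
  have h1 : Measurable (projIcc 0 (Γ.length e) (Γ.length_pos e).le) :=
    continuous_projIcc.measurable
  have h2 : Measurable (fun y : Icc (0 : ℝ) (Γ.length e) => (⟨e, y⟩ : Γ.EdgeUnion)) := by
    intro s hs
    exact (MeasurableSpace.measurableSet_iInf.1 hs) e
  have h3 : Measurable (fun y : Γ.EdgeUnion => (Quot.mk _ y : Γ.Point)) := fun s hs => hs
  exact h3.comp (h2.comp h1)

/-- The Lebesgue measure `dx` on the metric graph. -/
noncomputable def lebesgue : Measure Γ.Point :=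
  Measure.sum fun e => (volume.restrict (Icc 0 (Γ.length e))).map (Γ.edge e)

/-- The total length `L(Γ)`. -/
def totalLength [Fintype E] : ℝ := ∑ e, Γ.length e

/-- The length of the shortest edge. -/
def minLength [Fintype E] [Nonempty E] : ℝ :=
  Finset.univ.inf' Finset.univ_nonempty Γ.length

/-- The derivative of a function along the edge `e` (one-sided at the two ends). -/
noncomputable def edgeDeriv (f : Γ.Point → ℝ) (e : E) (x : ℝ) : ℝ :=
  derivWithin (fun t => f (Γ.edge e t)) (Icc 0 (Γ.length e)) x

/-- The derivative at an edge end, in the direction pointing into the edge. -/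
noncomputable def inwardDeriv (f : Γ.Point → ℝ) : E × Bool → ℝ
  | (e, false) => Γ.edgeDeriv f e 0
  | (e, true) => -Γ.edgeDeriv f e (Γ.length e)

open Classical in
/-- The sum of the inward derivatives over all edge ends at the vertex `v`. -/
noncomputable def vertexFlux [Fintype E] (f : Γ.Point → ℝ) (v : V) : ℝ :=
  ∑ s with Γ.vertexOf s = v, Γ.inwardDeriv f s

/-- The `δ`-coupling condition of strength `a ∈ ℝ ∪ {∞}` at the vertex `v`; infinite strength
means the Dirichlet condition. -/
def DeltaCoupling [Fintype E] (f : Γ.Point → ℝ) (v : V) : WithTop ℝ → Prop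
  | ⊤ => f (Γ.vertex v) = 0
  | (a : ℝ) => Γ.vertexFlux f v = a * f (Γ.vertex v)

/-- `f` solves the eigenvalue problem of the Schrödinger operator `-d²/dx² + q` with coupling
strengths `α` and spectral parameter `μ`.  As `q` is only integrable, the equation is understood
in the sense of Carathéodory: on each edge `f` is differentiable with absolutely continuous
derivative, and `-f'' + q f = μ f` holds almost everywhere. -/
structure IsSolution [Fintype E] (q : Γ.Point → ℝ) (α : V → WithTop ℝ) (μ : ℝ)
    (f : Γ.Point → ℝ) : Prop where
  continuous : Continuous f
  differentiableOn : ∀ e,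
    DifferentiableOn ℝ (fun x => f (Γ.edge e x)) (Icc 0 (Γ.length e))
  absolutelyContinuous : ∀ e,
    AbsolutelyContinuousOnInterval (Γ.edgeDeriv f e) 0 (Γ.length e)
  equation : ∀ e, ∀ᵐ x : ℝ, x ∈ Ioo 0 (Γ.length e) →
    -deriv (Γ.edgeDeriv f e) x + q (Γ.edge e x) * f (Γ.edge e x) = μ * f (Γ.edge e x)
  coupling : ∀ v, Γ.DeltaCoupling f v (α v)

section Linear

variable {Γ}

theorem edgeDeriv_lin {f g : Γ.Point → ℝ} {e : E} (a b : ℝ)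
    (hf : DifferentiableOn ℝ (fun x => f (Γ.edge e x)) (Icc 0 (Γ.length e)))
    (hg : DifferentiableOn ℝ (fun x => g (Γ.edge e x)) (Icc 0 (Γ.length e)))
    {x : ℝ} (hx : x ∈ Icc 0 (Γ.length e)) :
    Γ.edgeDeriv (a • f + b • g) e x = a * Γ.edgeDeriv f e x + b * Γ.edgeDeriv g e x := by
  have hu := uniqueDiffOn_Icc (Γ.length_pos e) x hx
  exact (((hf x hx).hasDerivWithinAt.const_mul a).add
    ((hg x hx).hasDerivWithinAt.const_mul b)).derivWithin hu

theorem IsSolution.lin [Fintype E] {q : Γ.Point → ℝ} {α : V → WithTop ℝ} {μ : ℝ}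
    {f g : Γ.Point → ℝ} (hf : Γ.IsSolution q α μ f) (hg : Γ.IsSolution q α μ g) (a b : ℝ) :
    Γ.IsSolution q α μ (a • f + b • g) := by
  have key : ∀ e, ∀ x ∈ Icc 0 (Γ.length e), Γ.edgeDeriv (a • f + b • g) e x =
      a * Γ.edgeDeriv f e x + b * Γ.edgeDeriv g e x := fun e x hx =>
    edgeDeriv_lin a b (hf.differentiableOn e) (hg.differentiableOn e) hx
  refine ⟨(hf.continuous.const_smul a).add (hg.continuous.const_smul b), fun e => ?_,
    fun e => ?_, fun e => ?_, fun v => ?_⟩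
  · exact ((hf.differentiableOn e).const_mul a).add ((hg.differentiableOn e).const_mul b)
  · have h := ((hf.absolutelyContinuous e).const_mul a).add
      ((hg.absolutelyContinuous e).const_mul b)
    rw [absolutelyContinuousOnInterval_iff] at h ⊢
    intro ε hε
    obtain ⟨δ, hδ, H⟩ := h ε hε
    refine ⟨δ, hδ, fun I hI hlt => ?_⟩
    have h2 := H I hI hlt
    convert h2 using 1
    refine Finset.sum_congr rfl fun i hi => ?_
    have hm := hI.1 i hi
    rw [uIcc_of_le (Γ.length_pos e).le] at hm
    rw [key e _ hm.1, key e _ hm.2]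
    rfl
  · have hle := (Γ.length_pos e).le
    filter_upwards [hf.equation e, hg.equation e,
      (hf.absolutelyContinuous e).ae_differentiableAt,
      (hg.absolutelyContinuous e).ae_differentiableAt] with x h1 h2 d1 d2 hx
    have hxI : x ∈ uIcc 0 (Γ.length e) := by
      rw [uIcc_of_le hle]; exact Ioo_subset_Icc_self hx
    have hd : deriv (Γ.edgeDeriv (a • f + b • g) e) x =
        a * deriv (Γ.edgeDeriv f e) x + b * deriv (Γ.edgeDeriv g e) x := by
      have hev : Γ.edgeDeriv (a • f + b • g) e =ᶠ[𝓝 x]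
          fun y => a * Γ.edgeDeriv f e y + b * Γ.edgeDeriv g e y := by
        filter_upwards [Icc_mem_nhds hx.1 hx.2] with y hy using key e y hy
      rw [hev.deriv_eq]
      exact (((d1 hxI).hasDerivAt.const_mul a).add ((d2 hxI).hasDerivAt.const_mul b)).deriv
    have e1 := h1 hx
    have e2 := h2 hx
    simp only [Pi.add_apply, Pi.smul_apply, smul_eq_mul]
    rw [hd]
    linear_combination a * e1 + b * e2
  · have hflux : Γ.vertexFlux (a • f + b • g) v =
        a * Γ.vertexFlux f v + b * Γ.vertexFlux g v := by
      simp only [vertexFlux, Finset.mul_sum, ← Finset.sum_add_distrib]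
      refine Finset.sum_congr rfl fun s _ => ?_
      obtain ⟨e, s⟩ := s
      have hle := (Γ.length_pos e).le
      cases s
      · exact key e 0 ⟨le_rfl, hle⟩
      · have := key e _ ⟨hle, le_rfl⟩
        simp only [inwardDeriv]
        rw [this]
        ring
    have h1 := hf.coupling v
    have h2 := hg.coupling v
    generalize α v = c at h1 h2 ⊢
    induction c with
    | top =>
      simp only [DeltaCoupling] at h1 h2
      simp [DeltaCoupling, h1, h2]
    | coe c =>
      simp only [DeltaCoupling] at h1 h2
      simp only [DeltaCoupling, hflux, h1, h2, Pi.add_apply, Pi.smul_apply, smul_eq_mul]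
      ring

theorem IsSolution.zero [Fintype E] (q : Γ.Point → ℝ) (α : V → WithTop ℝ) (μ : ℝ) :
    Γ.IsSolution q α μ 0 := by
  have hz : ∀ e, Γ.edgeDeriv (0 : Γ.Point → ℝ) e = fun _ => 0 := by
    intro e
    funext x
    simp [edgeDeriv]
  refine ⟨continuous_zero, fun e => differentiableOn_const 0, fun e => ?_, fun e => ?_,
    fun v => ?_⟩
  · rw [hz, absolutelyContinuousOnInterval_iff]
    exact fun ε hε => ⟨1, one_pos, fun I _ _ => by simpa using hε⟩
  · simp [hz]
  · have hflux : Γ.vertexFlux (0 : Γ.Point → ℝ) v = 0 := by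
      refine Finset.sum_eq_zero fun s _ => ?_
      obtain ⟨e, s⟩ := s
      cases s <;> simp [inwardDeriv, hz]
    generalize α v = c
    induction c with
    | top => simp [DeltaCoupling]
    | coe c => simp [DeltaCoupling, hflux]

end Linear

/-- The eigenspace of the Schrödinger operator with potential `q` and coupling strengths `α`
for the value `μ`; it is nonzero precisely when `μ` is an eigenvalue. -/
def eigenspace [Fintype E] (q : Γ.Point → ℝ) (α : V → WithTop ℝ) (μ : ℝ) :
    Submodule ℝ (Γ.Point → ℝ) where
  carrier := {f | Γ.IsSolution q α μ f}
  add_mem' {f g} hf hg := by simpa using IsSolution.lin hf hg 1 1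
  zero_mem' := IsSolution.zero q α μ
  smul_mem' c f hf := by simpa using IsSolution.lin hf hf c 0

/-- `lam 1 ≤ lam 2 ≤ lam 3 ≤ ⋯ ↗ ∞` is the sequence of all eigenvalues of the Schrödinger
operator, every eigenvalue being repeated according to its multiplicity
(the value `lam 0` plays no role). -/
structure IsEigenvalueSequence [Fintype E] (q : Γ.Point → ℝ) (α : V → WithTop ℝ)
    (lam : ℕ → ℝ) : Prop where
  le_of_le : ∀ j k, 1 ≤ j → j ≤ k → lam j ≤ lam k
  tendsto_atTop : Tendsto lam atTop atTop
  finiteDimensional : ∀ μ, FiniteDimensional ℝ (Γ.eigenspace q α μ)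
  multiplicity : ∀ μ,
    {k | 1 ≤ k ∧ lam k = μ}.ncard = Module.finrank ℝ (Γ.eigenspace q α μ)

end MetricGraph

/-! Put `n = |E|` and `a = L(Γ) / (k - 1 + n)`. An edge of length `ℓ` contains `⌊ℓ/a⌋` disjoint
intervals of length `a`, and summing `ℓ/a < ⌊ℓ/a⌋ + 1` over the edges shows that there are at least
`k` of them in all (`le_sum_floor`). Each carries half a period of a sine. This bump vanishes at all
vertices, so it lies in the form domain for every choice of `α`, and the couplings do not enter its
energy. Its Rayleigh quotient is `π²/a²` plus the integral of `q` against a probability density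
bounded by `2/a`. By Jensen's inequality that integral is at most `(2/a)^(1/p) ‖q₊‖_p`
(`energy_bump_le`). Disjoint supports make the bumps orthogonal both for the energy form and in
`L²`, so the min-max principle yields `k` eigenvalues up to that bound (`card_le_sum_finrank`).
Finally `k - 1 + n ≤ k n` and `n ℓ_min ≤ L(Γ)` give `2/a ≤ 2k/ℓ_min` (`eigenvalue_bound_le`).

Min-max is proved for an abstract semibounded form with a compact injection `J` into a Hilbert
space: the shifted form is inverted by Lax–Milgram, and the spectral theorem is applied to the
resulting compact symmetric operator (`mul_inner_le_apply_self`). For the graph, the form lives on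
the `H¹` functions on the edges that are continuous at the vertices and vanish at the Dirichlet
ones. Compactness of the embedding comes from Arzelà–Ascoli.

The abstract eigenvectors are weak solutions. Integration by parts and a du Bois-Reymond argument
identify them with the solutions of the boundary value problem (`map_toFun_weakEigenspace`). Since
the number of eigenvalues up to `M` is finite for each `M` and unbounded in `M`, they can be listed
in a sequence (`exists_sequence_of_multiplicity`). -/

/-! ### Spectral theory of semibounded forms and the min-max count. -/

section AbstractSpectral

open Module.End

/-- A bilinear form with vanishing off-diagonal terms is diagonal on sums. -/
theorem LinearMap.apply_sum_sum_of_pairwise_eq_zero {V ι : Type*} [AddCommGroup V] [Module ℝ V]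
    (B : V →ₗ[ℝ] V →ₗ[ℝ] ℝ) (s : Finset ι) (f : ι → V)
    (h : ∀ i ∈ s, ∀ j ∈ s, i ≠ j → B (f i) (f j) = 0) :
    B (∑ i ∈ s, f i) (∑ i ∈ s, f i) = ∑ i ∈ s, B (f i) (f i) := by
  simp only [map_sum, LinearMap.sum_apply]
  refine Finset.sum_congr rfl fun i hi => ?_
  rw [Finset.sum_eq_single i (fun j hj hji => h j hj i hi hji)
    (fun hn => absurd hi hn)]

/-- A bilinear form that is nonnegative on each of a family of pairwise orthogonal subspaces is
nonnegative on their span. -/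
theorem LinearMap.apply_self_nonneg_of_mem_iSup {V ι : Type*} [AddCommGroup V] [Module ℝ V]
    (B : V →ₗ[ℝ] V →ₗ[ℝ] ℝ) (W : ι → Submodule ℝ V)
    (horth : ∀ i j, i ≠ j → ∀ u ∈ W i, ∀ v ∈ W j, B u v = 0)
    (hnn : ∀ i, ∀ u ∈ W i, 0 ≤ B u u) {u : V} (hu : u ∈ ⨆ i, W i) : 0 ≤ B u u := by
  obtain ⟨f, hf, rfl⟩ := (Submodule.mem_iSup_iff_exists_finsupp W u).1 hu
  rw [Finsupp.sum, LinearMap.apply_sum_sum_of_pairwise_eq_zero B f.support f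
    (fun i _ j _ hij => horth i j hij _ (hf i) _ (hf j))]
  exact Finset.sum_nonneg fun i _ => hnn i _ (hf i)

/-- The quadratic form of a compact symmetric operator is at most `m` on vectors orthogonal to
all eigenvectors with eigenvalue at least `m`. -/
theorem ContinuousLinearMap.inner_apply_self_le_of_orthogonal {K : Type*} [NormedAddCommGroup K]
    [InnerProductSpace ℝ K] [CompleteSpace K] {T : K →L[ℝ] K} (hT : IsCompactOperator T)
    (hT' : T.IsSymmetric) {m : ℝ} {k : K}
    (hk : ∀ μ, m ≤ μ → ∀ x ∈ eigenspace (T : Module.End ℝ K) μ, inner ℝ x k = 0) :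
    inner ℝ (T k) k ≤ m * inner ℝ k k := by
  set G : {μ : ℝ // μ < m} → Submodule ℝ K := fun μ => eigenspace (T : Module.End ℝ K) μ
  set Q : Submodule ℝ K := (⨆ μ, G μ).topologicalClosure
  have horth : ∀ μ ν : ℝ, μ ≠ ν → ∀ x ∈ eigenspace (T : Module.End ℝ K) μ,
      ∀ y ∈ eigenspace (T : Module.End ℝ K) ν, inner ℝ x y = 0 := fun μ ν hμν x hx y hy =>
    LinearMap.IsSymmetric.orthogonalFamily_eigenspaces hT' hμν ⟨x, hx⟩ ⟨y, hy⟩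
  have hnn : ∀ x ∈ Q, inner ℝ (T x) x ≤ m * inner ℝ x x := by
    set B : K →ₗ[ℝ] K →ₗ[ℝ] ℝ :=
      (innerₗ K).comp (m • LinearMap.id - (T : K →ₗ[ℝ] K)) with hB
    have hBa : ∀ x y, B x y = m * inner ℝ x y - inner ℝ (T x) y := fun x y => by
      simp [hB]
    have key : ∀ x ∈ ⨆ μ, G μ, 0 ≤ B x x := fun x hx => by
      refine LinearMap.apply_self_nonneg_of_mem_iSup B G ?_ ?_ hx
      · intro i j hij x hx y hy
        have h0 := horth i j (fun h => hij (Subtype.ext h)) x hx y hy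
        have h1 : T x = (i : ℝ) • x := mem_eigenspace_iff.1 hx
        rw [hBa, h1, inner_smul_left, h0]; simp
      · intro i x hx
        have h1 : T x = (i : ℝ) • x := mem_eigenspace_iff.1 hx
        rw [hBa, h1, inner_smul_left]
        have := i.2
        have h2 : (0 : ℝ) ≤ inner ℝ x x := real_inner_self_nonneg
        simp only [conj_trivial]
        nlinarith
    have hcl : IsClosed {x : K | inner ℝ (T x) x ≤ m * inner ℝ x x} :=
      isClosed_le (by fun_prop) (by fun_prop)
    intro x hx
    refine (closure_minimal (fun y hy => ?_) hcl) hx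
    have := key y hy
    rw [hBa] at this
    simpa using this
  have hcomp : CompleteSpace Q := (Submodule.isClosed_topologicalClosure _).completeSpace_coe
  -- `k₂` is orthogonal to the eigenspaces below `m` by construction, and to the others because `k`
  -- and `k₁` are. The eigenspaces of a compact symmetric operator have dense span, so `k₂ = 0`.
  obtain ⟨k₁, hk₁, k₂, hk₂, rfl⟩ := Submodule.exists_add_mem_mem_orthogonal (K := Q) k
  have hk₁' : ∀ μ, m ≤ μ → ∀ x ∈ eigenspace (T : Module.End ℝ K) μ, inner ℝ x k₁ = 0 := by
    intro μ hμ x hx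
    have hcl : IsClosed {y : K | inner ℝ x y = 0} := isClosed_eq (by fun_prop) (by fun_prop)
    refine (closure_minimal (fun y hy => ?_) hcl) hk₁
    have : (⨆ μ, G μ) ≤ LinearMap.ker (innerₗ K x) := iSup_le fun ν z hz => by
      have := horth μ ν (ne_of_gt (lt_of_lt_of_le ν.2 hμ)) x hx z hz
      simpa using this
    simpa using this hy
  have hzero : k₂ = 0 := by
    have h := ContinuousLinearMap.orthogonalComplement_iSup_eigenspaces_eq_bot hT hT'
    have h2 : k₂ ∈ (⨆ μ, eigenspace (T : Module.End ℝ K) μ)ᗮ := by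
      rw [← Submodule.iInf_orthogonal, Submodule.mem_iInf]
      intro μ x hx
      rcases lt_or_ge μ m with hμ | hμ
      · refine hk₂ x (Submodule.le_topologicalClosure _ ?_)
        exact Submodule.mem_iSup_of_mem (p := G) ⟨μ, hμ⟩ hx
      · have h1 := hk μ hμ x hx
        rwa [inner_add_right, hk₁' μ hμ x hx, zero_add] at h1
    rwa [h, Submodule.mem_bot] at h2
  rw [hzero, add_zero]
  exact hnn _ hk₁

variable {V K : Type*} [NormedAddCommGroup V] [InnerProductSpace ℝ V]
  [NormedAddCommGroup K] [InnerProductSpace ℝ K]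

/-- The solutions `u` of the weak eigenvalue equation `a u v = l ⟪J u, J v⟫` for all `v`. -/
def weakEigenspace (a : V →ₗ[ℝ] V →ₗ[ℝ] ℝ) (J : V →L[ℝ] K) (l : ℝ) : Submodule ℝ V where
  carrier := {u | ∀ v, a u v = l * inner ℝ (J u) (J v)}
  add_mem' {u w} hu hw v := by
    simp only [mem_ofPred_eq] at hu hw
    simp [hu v, hw v, inner_add_left, mul_add]
  zero_mem' v := by simp
  smul_mem' c u hu v := by
    simp only [mem_ofPred_eq] at hu
    simp [hu v, inner_smul_left]
    ring

/-- A bounded symmetric form `a`, semibounded with respect to a compact injective map `J` into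
the Hilbert space `K`. -/
structure IsSemiboundedForm (a : V →ₗ[ℝ] V →ₗ[ℝ] ℝ) (J : V →L[ℝ] K) : Prop where
  symm : ∀ u v, a u v = a v u
  bounded : ∃ M, ∀ u v, ‖a u v‖ ≤ M * ‖u‖ * ‖v‖
  isCompact : IsCompactOperator J
  injective : Function.Injective J
  coercive : ∃ C c : ℝ, 0 < c ∧ ∀ u, c * ‖u‖ ^ 2 ≤ a u u + C * inner ℝ (J u) (J u)

namespace IsSemiboundedForm

variable {a : V →ₗ[ℝ] V →ₗ[ℝ] ℝ} {J : V →L[ℝ] K}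

theorem inner_eq_zero_of_ne (h : IsSemiboundedForm a J) {l m : ℝ} (hlm : l ≠ m) {u v : V}
    (hu : u ∈ weakEigenspace a J l) (hv : v ∈ weakEigenspace a J m) :
    inner ℝ (J u) (J v) = 0 := by
  have h1 := hu v
  rw [h.symm, hv u, real_inner_comm] at h1
  have h2 : (m - l) * inner ℝ (J u) (J v) = 0 := by linear_combination h1
  exact (mul_eq_zero.1 h2).resolve_left (sub_ne_zero.2 hlm.symm)

/-- Weak eigenvectors for different values are orthogonal both for `a` and for the inner product
pulled back by `J`. Hence `M ⟪J ·, J ·⟫ - a` is diagonal on the sum and nonnegative on each summand.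
-/
theorem apply_self_le_of_mem_iSup (h : IsSemiboundedForm a J) {M : ℝ} {u : V}
    (hu : u ∈ ⨆ l : {l : ℝ // l ≤ M}, weakEigenspace a J l) :
    a u u ≤ M * inner ℝ (J u) (J u) := by
  set B : V →ₗ[ℝ] V →ₗ[ℝ] ℝ :=
    M • (innerₗ K).compl₁₂ (J : V →ₗ[ℝ] K) (J : V →ₗ[ℝ] K) - a with hB
  have hBa : ∀ x y, B x y = M * inner ℝ (J x) (J y) - a x y := fun x y => by simp [hB]
  have := LinearMap.apply_self_nonneg_of_mem_iSup B _ ?_ ?_ hu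
  · rw [hBa] at this
    linarith
  · intro i j hij x hx y hy
    rw [hBa, hx y, h.inner_eq_zero_of_ne (fun h => hij (Subtype.ext h)) hx hy]
    simp
  · intro i x hx
    rw [hBa, hx x]
    have := i.2
    have h2 : (0 : ℝ) ≤ inner ℝ (J x) (J x) := real_inner_self_nonneg
    nlinarith

variable [CompleteSpace V]

/-- On this span `a u u ≤ M ‖J u‖²`, so coercivity bounds `‖u‖` by a multiple of `‖J u‖`. Then `J`
is both compact and bounded below on the closed span, which makes the identity there compact. -/
theorem finiteDimensional_iSup (h : IsSemiboundedForm a J) (M : ℝ) :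
    FiniteDimensional ℝ (⨆ l : {l : ℝ // l ≤ M}, weakEigenspace a J l : Submodule ℝ V) := by
  obtain ⟨C, c, hc, hco⟩ := h.coercive
  set P : Submodule ℝ V := ⨆ l : {l : ℝ // l ≤ M}, weakEigenspace a J l
  -- The maximum with `1` only keeps the constant positive.
  set D : ℝ := max (M + C) 1
  have hle : ∀ u ∈ P.topologicalClosure, c * ‖u‖ ^ 2 ≤ D * ‖J u‖ ^ 2 := by
    have hcl : IsClosed {u : V | c * ‖u‖ ^ 2 ≤ D * ‖J u‖ ^ 2} :=
      isClosed_le (by fun_prop) (by fun_prop)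
    intro u hu
    refine (closure_minimal (fun y hy => ?_) hcl) hu
    have h1 := h.apply_self_le_of_mem_iSup hy
    have h2 := hco y
    rw [real_inner_self_eq_norm_sq] at h1 h2
    have h3 : (M + C) * ‖J y‖ ^ 2 ≤ D * ‖J y‖ ^ 2 := by
      gcongr
      exact le_max_left _ _
    simp only [mem_ofPred_eq]
    linarith
  have hDpos : 0 < D := lt_of_lt_of_le one_pos (le_max_right _ _)
  have hcomp : CompleteSpace P.topologicalClosure :=
    (Submodule.isClosed_topologicalClosure _).completeSpace_coe
  set S : P.topologicalClosure →L[ℝ] K := J.comp P.topologicalClosure.subtypeL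
  have hanti : AntilipschitzWith (Real.toNNReal (√(D / c))) S := by
    refine S.antilipschitz_of_bound fun x => ?_
    rw [Real.coe_toNNReal _ (Real.sqrt_nonneg _)]
    refine abs_le_of_sq_le_sq' ?_ (by positivity) |>.2
    rw [mul_pow, Real.sq_sqrt (by positivity), div_mul_eq_mul_div, le_div_iff₀ hc]
    have := hle x x.2
    rw [mul_comm]
    exact this
  have hScl : IsClosedEmbedding S := hanti.isClosedEmbedding S.uniformContinuous
  have hScomp : IsCompactOperator S := h.isCompact.comp_clm _
  obtain ⟨A, hA, hA'⟩ := hScomp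
  have hid : IsCompactOperator (id : P.topologicalClosure → P.topologicalClosure) :=
    ⟨S ⁻¹' A, hScl.isCompact_preimage hA, hA'⟩
  have hfin : FiniteDimensional ℝ P.topologicalClosure :=
    FiniteDimensional.of_isCompactOperator_id hid
  exact Submodule.finiteDimensional_of_le P.le_topologicalClosure

theorem finiteDimensional_weakEigenspace (h : IsSemiboundedForm a J) (l : ℝ) :
    FiniteDimensional ℝ (weakEigenspace a J l) :=
  have := h.finiteDimensional_iSup l
  Submodule.finiteDimensional_of_le
    (le_iSup (fun m : {m : ℝ // m ≤ l} => weakEigenspace a J m) ⟨l, le_rfl⟩)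

/-- One eigenvector per value gives a family with orthogonal nonzero images under `J`, hence an
independent family in a finite-dimensional space. -/
theorem finite_setOf_le (h : IsSemiboundedForm a J) (M : ℝ) :
    {l : ℝ | l ≤ M ∧ weakEigenspace a J l ≠ ⊥}.Finite := by
  have hfin := h.finiteDimensional_iSup M
  set P : Submodule ℝ V := ⨆ l : {l : ℝ // l ≤ M}, weakEigenspace a J l
  have hex : ∀ l : {l : ℝ | l ≤ M ∧ weakEigenspace a J l ≠ ⊥},
      ∃ u ∈ weakEigenspace a J l, u ≠ 0 := fun l => Submodule.exists_mem_ne_zero_of_ne_bot l.2.2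
  choose u hu hu0 using hex
  have hmem : ∀ l, u l ∈ P := fun l =>
    Submodule.mem_iSup_of_mem (p := fun l : {l : ℝ // l ≤ M} => weakEigenspace a J l)
      ⟨l, l.2.1⟩ (hu l)
  have hJ : LinearIndependent ℝ fun l => J (u l) :=
    linearIndependent_of_ne_zero_of_inner_eq_zero
      (fun l h0 => hu0 l (h.injective (h0.trans (map_zero J).symm)))
      (fun l m hlm => h.inner_eq_zero_of_ne (fun h => hlm (Subtype.ext h)) (hu l) (hu m))
  have hli : LinearIndependent ℝ fun l => (⟨u l, hmem l⟩ : P) :=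
    LinearIndependent.of_comp ((J : V →ₗ[ℝ] K).comp P.subtype) hJ
  have : Finite {l : ℝ | l ≤ M ∧ weakEigenspace a J l ≠ ⊥} :=
    hli.finite
  exact Set.toFinite _

variable [CompleteSpace K]

/-- The form is at least `M` on vectors orthogonal to all eigenvectors with eigenvalue at most
`M`. -/
theorem mul_inner_le_apply_self (h : IsSemiboundedForm a J) {M : ℝ} {u : V}
    (hu : ∀ l ≤ M, ∀ w ∈ weakEigenspace a J l, inner ℝ (J u) (J w) = 0) :
    M * inner ℝ (J u) (J u) ≤ a u u := by
  obtain ⟨C, c, hc, hco⟩ := h.coercive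
  obtain ⟨D, hD⟩ := h.bounded
  have hnn : ∀ v, 0 ≤ a v v + C * inner ℝ (J v) (J v) := fun v =>
    le_trans (by positivity) (hco v)
  -- For `M + C ≤ 0` semiboundedness alone suffices. Otherwise `(M + C)⁻¹` is a meaningful threshold
  -- for the inverse of the shifted form `b`.
  rcases le_or_gt (M + C) 0 with hMC | hMC
  · nlinarith [hnn u, real_inner_self_nonneg (x := J u)]
  set b : V →L[ℝ] V →L[ℝ] ℝ :=
    (a + C • (innerₗ K).compl₁₂ (J : V →ₗ[ℝ] K) (J : V →ₗ[ℝ] K)).mkContinuous₂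
      (D + |C| * (‖J‖ * ‖J‖)) (fun v w => by
        have h1 := norm_inner_le_norm (𝕜 := ℝ) (J v) (J w)
        have h2 : ‖J v‖ * ‖J w‖ ≤ (‖J‖ * ‖v‖) * (‖J‖ * ‖w‖) := by
          gcongr <;> exact J.le_opNorm _
        calc ‖a v w + C * inner ℝ (J v) (J w)‖ ≤ ‖a v w‖ + |C| * ‖(inner ℝ (J v) (J w) : ℝ)‖ := by
              rw [← Real.norm_eq_abs C, ← norm_mul]
              exact norm_add_le _ _
          _ ≤ D * ‖v‖ * ‖w‖ + |C| * ((‖J‖ * ‖v‖) * (‖J‖ * ‖w‖)) := by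
              gcongr
              · exact hD v w
              · exact h1.trans h2
          _ = _ := by ring)
  have hba : ∀ v w, b v w = a v w + C * inner ℝ (J v) (J w) := fun v w => rfl
  have hbsymm : ∀ v w, b v w = b w v := fun v w => by
    rw [hba, hba, h.symm, real_inner_comm]
  have hbco : IsCoercive b := ⟨c, hc, fun v => by
    rw [hba, mul_assoc, ← sq]
    exact hco v⟩
  set A := hbco.continuousLinearEquivOfBilin
  have hAb : ∀ v w, inner ℝ (A v) w = b v w := hbco.continuousLinearEquivOfBilin_apply
  set Jt : K →L[ℝ] V := ContinuousLinearMap.adjoint J with hJt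
  -- `G k` is the Lax–Milgram solution of `b (G k) v = ⟪k, J v⟫`. A positive eigenvalue `μ` of `J ∘
  -- G` corresponds to the weak eigenvalue `μ⁻¹ - C`, so `μ ≥ (M + C)⁻¹` means `μ⁻¹ - C ≤ M`.
  set G : K →L[ℝ] V := (A.symm : V →L[ℝ] V).comp Jt with hG
  have hGb : ∀ k v, b (G k) v = inner ℝ k (J v) := fun k v => by
    rw [← hAb]
    simp [hG, hJt, ContinuousLinearMap.adjoint_inner_left]
  set R : K →L[ℝ] K := J.comp G
  have hRc : IsCompactOperator R := h.isCompact.comp_clm G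
  have hRs : R.IsSymmetric := fun x y => by
    change inner ℝ (J (G x)) y = inner ℝ x (J (G y))
    rw [← hGb x (G y), hbsymm, hGb y (G x), real_inner_comm]
  have hRle : inner ℝ (R (J u)) (J u) ≤ (M + C)⁻¹ * inner ℝ (J u) (J u) := by
    refine ContinuousLinearMap.inner_apply_self_le_of_orthogonal hRc hRs fun μ hμ x hx => ?_
    have hμ0 : 0 < μ := lt_of_lt_of_le (by positivity) hμ
    have hx' : J (G x) = μ • x := Module.End.mem_eigenspace_iff.1 hx
    have hxJ : x = J (μ⁻¹ • G x) := by
      rw [map_smul, hx', smul_smul, inv_mul_cancel₀ hμ0.ne', one_smul]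
    have hw : μ⁻¹ • G x ∈ weakEigenspace a J (μ⁻¹ - C) := by
      intro v
      have h1 : b (μ⁻¹ • G x) v = μ⁻¹ * inner ℝ (J (μ⁻¹ • G x)) (J v) := by
        rw [← hxJ, map_smul, smul_apply, hGb, smul_eq_mul]
      rw [hba] at h1
      linear_combination h1
    have hl : μ⁻¹ - C ≤ M := by
      have := inv_anti₀ (by positivity) hμ
      rw [inv_inv] at this
      linarith
    rw [hxJ, real_inner_comm]
    exact hu _ hl _ hw
  -- The upper bound for `⟪R (J u), J u⟫ = b w w` becomes a lower bound for `b u u` by positivity of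
  -- `b` at `u - (M + C) w`. The factor `M + C` is what makes the two bounds combine to `(M + C) ‖J
  -- u‖² ≤ b u u`.
  set w := G (J u) with hw
  have h1 : b w w = inner ℝ (R (J u)) (J u) := by
    rw [hGb, real_inner_comm]; rfl
  have h2 : b w u = inner ℝ (J u) (J u) := hGb _ _
  -- expanding `0 ≤ b (u - (M + C) w) (u - (M + C) w)`
  have h3 : 0 ≤ b (u - (M + C) • w) (u - (M + C) • w) := by
    rw [hba]
    exact hnn _
  have h4 : b (u - (M + C) • w) (u - (M + C) • w) =
      b u u - 2 * (M + C) * b w u + (M + C) ^ 2 * b w w := by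
    simp only [map_sub, map_smul, sub_apply, smul_apply,
      smul_eq_mul]
    rw [hbsymm u w]
    ring
  have h5 : (M + C) ^ 2 * b w w ≤ (M + C) * inner ℝ (J u) (J u) := by
    rw [h1]
    calc _ ≤ (M + C) ^ 2 * ((M + C)⁻¹ * inner ℝ (J u) (J u)) := by gcongr
      _ = _ := by field_simp
  rw [h4, h2, hba] at h3
  linarith

/-- The number of eigenvalues up to `M`, with multiplicity, is at least the number of pairwise
orthogonal trial vectors with Rayleigh quotients at most `M`. -/
theorem card_le_sum_finrank (h : IsSemiboundedForm a J) {ι : Type*} [Fintype ι] {M : ℝ}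
    (u : ι → V) (hu0 : ∀ i, u i ≠ 0) (ha : ∀ i j, i ≠ j → a (u i) (u j) = 0)
    (hJ : ∀ i j, i ≠ j → inner ℝ (J (u i)) (J (u j)) = 0)
    (hle : ∀ i, a (u i) (u i) ≤ M * inner ℝ (J (u i)) (J (u i))) :
    Fintype.card ι ≤
      ∑ l ∈ (h.finite_setOf_le M).toFinset, Module.finrank ℝ (weakEigenspace a J l) := by
  by_contra! hlt
  set S := (h.finite_setOf_le M).toFinset with hS
  have hfd : ∀ l, FiniteDimensional ℝ (weakEigenspace a J l) := h.finiteDimensional_weakEigenspace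
  -- With too few eigenvalues, dimension counting gives a nonzero combination `v` of the trial
  -- vectors orthogonal to every weak eigenspace up to `M`.
  set Φ : (ι → ℝ) →ₗ[ℝ] (∀ l : S, Module.Dual ℝ (weakEigenspace a J l)) :=
    LinearMap.pi fun l => ((innerₗ K).compl₁₂ (J : V →ₗ[ℝ] K)
      ((J : V →ₗ[ℝ] K).comp (weakEigenspace a J l).subtype)).comp
        (Fintype.linearCombination ℝ u) with hΦ
  have hrank : Module.finrank ℝ (∀ l : S, Module.Dual ℝ (weakEigenspace a J l)) <
      Module.finrank ℝ (ι → ℝ) := by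
    rw [Module.finrank_pi_fintype, Module.finrank_fintype_fun_eq_card]
    simp only [Subspace.dual_finrank_eq]
    rwa [Finset.sum_coe_sort S fun l => Module.finrank ℝ (weakEigenspace a J l)]
  obtain ⟨x, hx, hx0⟩ := Submodule.exists_mem_ne_zero_of_ne_bot
    (LinearMap.ker_ne_bot_of_finrank_lt hrank (f := Φ))
  set v : V := ∑ i, x i • u i with hv
  have hv' : Fintype.linearCombination ℝ u x = v := by simp [Fintype.linearCombination_apply, hv]
  have horth : ∀ l ≤ M, ∀ w ∈ weakEigenspace a J l, inner ℝ (J v) (J w) = 0 := by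
    intro l hl w hw
    by_cases hbot : weakEigenspace a J l = ⊥
    · rw [hbot, Submodule.mem_bot] at hw
      simp [hw]
    · have hlS : l ∈ S := by simp [hS, hl, hbot]
      have h1 := congrArg (fun F => F ⟨w, hw⟩) (congrFun (LinearMap.mem_ker.1 hx) ⟨l, hlS⟩)
      simpa [hΦ, hv'] using h1
  have hav : a v v = ∑ i, x i ^ 2 * a (u i) (u i) := by
    rw [hv, LinearMap.apply_sum_sum_of_pairwise_eq_zero]
    · simp [sq, mul_assoc]
    · intro i _ j _ hij
      simp [ha i j hij]
  have hJv : inner ℝ (J v) (J v) = ∑ i, x i ^ 2 * inner ℝ (J (u i)) (J (u i)) := by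
    have := LinearMap.apply_sum_sum_of_pairwise_eq_zero
      ((innerₗ K).compl₁₂ (J : V →ₗ[ℝ] K) (J : V →ₗ[ℝ] K)) Finset.univ (fun i => x i • u i)
      (fun i _ j _ hij => by simp [hJ i j hij])
    rw [← hv] at this
    simpa [inner_smul_left, inner_smul_right, sq, mul_assoc] using this
  have hpos : 0 < inner ℝ (J v) (J v) := by
    obtain ⟨i, hi⟩ := Function.ne_iff.1 hx0
    rw [hJv]
    refine Finset.sum_pos' (fun j _ => mul_nonneg (sq_nonneg _) real_inner_self_nonneg)
      ⟨i, Finset.mem_univ i, mul_pos (sq_pos_of_ne_zero hi) (real_inner_self_pos.2 fun h0 => ?_)⟩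
    exact hu0 i (h.injective (h0.trans (map_zero J).symm))
  have hupper : a v v ≤ M * inner ℝ (J v) (J v) := by
    rw [hav, hJv, Finset.mul_sum]
    refine Finset.sum_le_sum fun i _ => ?_
    calc x i ^ 2 * a (u i) (u i) ≤ x i ^ 2 * (M * inner ℝ (J (u i)) (J (u i))) := by
          gcongr; exact hle i
      _ = _ := by ring
  -- The trial vectors give `a v v ≤ M ‖J v‖²`, and orthogonality at level `M` gives only the
  -- reverse inequality. As the eigenvalues are discrete, the level can be raised to some `M' > M`,
  -- which yields a contradiction.
  obtain ⟨M', hMM', hM'⟩ : ∃ M', M < M' ∧ ∀ l, M < l → l ≤ M' → weakEigenspace a J l = ⊥ := by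
    have hfin : ({l : ℝ | M < l ∧ l ≤ M + 1 ∧ weakEigenspace a J l ≠ ⊥}).Finite :=
      (h.finite_setOf_le (M + 1)).subset fun l hl => hl.2
    have hev : ∀ᶠ m in 𝓝[>] M, m < M + 1 ∧
        ∀ l ∈ {l : ℝ | M < l ∧ l ≤ M + 1 ∧ weakEigenspace a J l ≠ ⊥}, m < l := by
      refine nhdsWithin_le_nhds (Filter.Eventually.and (eventually_lt_nhds (lt_add_one M)) ?_)
      exact (Filter.eventually_all_finite hfin).2 fun l hl => eventually_lt_nhds hl.1
    obtain ⟨m, ⟨hm1, hm2⟩, hm3⟩ := (hev.and self_mem_nhdsWithin).exists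
    refine ⟨m, hm3, fun l hl hlm => ?_⟩
    by_contra hne
    exact absurd (hm2 l ⟨hl, hlm.trans hm1.le, hne⟩) (not_lt.2 hlm)
  have hlower : M' * inner ℝ (J v) (J v) ≤ a v v := by
    refine h.mul_inner_le_apply_self fun l hl w hw => ?_
    rcases le_or_gt l M with hlM | hlM
    · exact horth l hlM w hw
    · rw [hM' l hlM hl, Submodule.mem_bot] at hw
      simp [hw]
  nlinarith

end IsSemiboundedForm

end AbstractSpectral

/-! ### Listing a multiset of reals in increasing order. -/

section Enumeration

/-- In a nondecreasing sequence (from index `1` on) in which every value `l` occurs `d l` times,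
the `k`-th member is at most `M` if the multiplicities of the values up to `M` sum up to at
least `k`. -/
theorem le_of_le_sum_multiplicity {d : ℝ → ℕ} {lam : ℕ → ℝ}
    (hmono : ∀ j k, 1 ≤ j → j ≤ k → lam j ≤ lam k)
    (hd : ∀ l, {k | 1 ≤ k ∧ lam k = l}.ncard = d l) {S : Finset ℝ} {M : ℝ}
    (hS : ∀ l ∈ S, l ≤ M) {k : ℕ} (hk1 : 1 ≤ k) (hk : k ≤ ∑ l ∈ S, d l) : lam k ≤ M := by
  classical
  by_contra! hlt
  -- If `M < lam k`, monotonicity leaves only the indices `1, …, k - 1` for values up to `M`, one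
  -- too few.
  have h1 : ∀ l ∈ S, d l = ((Finset.Icc 1 (k - 1)).filter fun j => lam j = l).card := by
    intro l hl
    rw [← hd l, ← Set.ncard_coe_finset]
    congr 1
    ext j
    simp only [mem_ofPred_eq, Finset.coe_filter, Finset.mem_Icc]
    refine ⟨fun ⟨hj, hjl⟩ => ⟨⟨hj, ?_⟩, hjl⟩, fun ⟨hj, hjl⟩ => ⟨hj.1, hjl⟩⟩
    by_contra! hjk
    have := hmono k j hk1 (by omega)
    linarith [hS l hl]
  rw [Finset.sum_congr rfl h1] at hk
  have h2 : ∑ l ∈ S, ((Finset.Icc 1 (k - 1)).filter fun j => lam j = l).card ≤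
      (Finset.Icc 1 (k - 1)).card := by
    rw [← Finset.card_biUnion]
    · exact Finset.card_le_card (Finset.biUnion_subset.2 fun l _ => Finset.filter_subset _ _)
    · intro l _ m _ hlm
      refine Finset.disjoint_left.2 fun j hj hj' => hlm ?_
      rw [← (Finset.mem_filter.1 hj).2, ← (Finset.mem_filter.1 hj').2]
  rw [Nat.card_Icc] at h2
  omega

/-- Multiplicities that are finite on half-lines `(-∞, M]` and have infinite total sum can be
listed in a nondecreasing sequence tending to infinity. -/
theorem exists_sequence_of_multiplicity {d : ℝ → ℕ}
    (hfin : ∀ M, {l | l ≤ M ∧ d l ≠ 0}.Finite) (hunb : ∀ k, ∃ S : Finset ℝ, k ≤ ∑ l ∈ S, d l) :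
    ∃ lam : ℕ → ℝ, (∀ j k, 1 ≤ j → j ≤ k → lam j ≤ lam k) ∧ Tendsto lam atTop atTop ∧
      ∀ l, {k | 1 ≤ k ∧ lam k = l}.ncard = d l := by
  classical
  set T : ℝ → Finset ℝ := fun M => (hfin M).toFinset with hT
  set N : ℝ → ℕ := fun M => ∑ l ∈ T M, d l
  have hmT : ∀ {l M}, l ∈ T M ↔ l ≤ M ∧ d l ≠ 0 := by simp [hT]
  have hle : ∀ {S : Finset ℝ} {M : ℝ}, (∀ l ∈ S, l ≤ M) → ∑ l ∈ S, d l ≤ N M := by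
    intro S M hS
    rw [← Finset.sum_filter_ne_zero S]
    exact Finset.sum_le_sum_of_subset fun l hl =>
      hmT.2 ⟨hS l (Finset.mem_filter.1 hl).1, (Finset.mem_filter.1 hl).2⟩
  have hNmono : Monotone N := fun M M' h => hle fun l hl => (hmT.1 hl).1.trans h
  have hmax : ∀ S : Finset ℝ, 1 ≤ ∑ l ∈ S, d l → ∃ m ∈ S, ∑ l ∈ S, d l ≤ N m := by
    intro S hS
    have hne : S.Nonempty := by
      by_contra h
      rw [Finset.not_nonempty_iff_eq_empty.1 h] at hS
      simp at hS
    exact ⟨S.max' hne, S.max'_mem hne, hle fun l hl => S.le_max' l hl⟩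
  -- `lam k` is the least `l` with `k ≤ N l`, where `N` counts the values up to `l` with
  -- multiplicity. The minimum exists because `N` jumps only at points with `d ≠ 0`, finitely many
  -- below any bound. Index `0` gets a dummy value.
  have hex : ∀ k, ∃ l, 1 ≤ k → (k ≤ N l ∧ ∀ M, k ≤ N M → l ≤ M) := by
    intro k
    by_cases hk : 1 ≤ k
    · obtain ⟨S, hS⟩ := hunb k
      obtain ⟨M₀, -, hM₀⟩ := hmax S (hk.trans hS)
      have hkM₀ := hS.trans hM₀
      have hne : ((T M₀).filter fun l => k ≤ N l).Nonempty := by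
        obtain ⟨m, hm, hm'⟩ := hmax (T M₀) (hk.trans hkM₀)
        exact ⟨m, Finset.mem_filter.2 ⟨hm, hkM₀.trans hm'⟩⟩
      refine ⟨_, fun _ => ⟨(Finset.mem_filter.1 (Finset.min'_mem _ hne)).2, fun M hM => ?_⟩⟩
      obtain ⟨m, hm, hm'⟩ := hmax (T M) (hk.trans hM)
      rcases le_total M M₀ with h | h
      · refine (Finset.min'_le _ m (Finset.mem_filter.2 ⟨?_, hM.trans hm'⟩)).trans (hmT.1 hm).1
        exact hmT.2 ⟨(hmT.1 hm).1.trans h, (hmT.1 hm).2⟩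
      · exact (hmT.1 (Finset.mem_filter.1 (Finset.min'_mem _ hne)).1).1.trans h
    · exact ⟨0, fun h => absurd h hk⟩
  choose lam hlam using hex
  have hgc : ∀ k M, 1 ≤ k → (lam k ≤ M ↔ k ≤ N M) := fun k M hk =>
    ⟨fun h => (hlam k hk).1.trans (hNmono h), (hlam k hk).2 M⟩
  refine ⟨lam, fun j k hj hjk => (hgc j _ hj).2 (hjk.trans (hlam k (hj.trans hjk)).1), ?_,
    fun l => ?_⟩
  · refine tendsto_atTop.2 fun M => ?_
    filter_upwards [eventually_ge_atTop (N M + 1)] with k hk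
    by_contra! h
    have := (hgc k M (by omega)).1 h.le
    omega
  · have hsplit : N l = ∑ x ∈ (T l).erase l, d x + d l := by
      by_cases h : l ∈ T l
      · exact (Finset.sum_erase_add _ _ h).symm
      · have : d l = 0 := by
          by_contra h0
          exact h (hmT.2 ⟨le_rfl, h0⟩)
        rw [Finset.erase_eq_of_notMem h, this, add_zero]
    -- The indices of the value `l` run from just above the count of values strictly below `l` up to
    -- `N l`.
    have hset : {k | 1 ≤ k ∧ lam k = l} = ↑(Finset.Ioc (∑ x ∈ (T l).erase l, d x) (N l)) := by
      ext k
      simp only [mem_ofPred_eq, Finset.coe_Ioc, mem_Ioc]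
      constructor
      · rintro ⟨hk, rfl⟩
        refine ⟨?_, (hlam k hk).1⟩
        by_contra! h
        obtain ⟨m, hm, hm'⟩ := hmax _ (hk.trans h)
        have h1 := (hgc k m hk).2 (h.trans hm')
        exact (Finset.mem_erase.1 hm).1 (le_antisymm (hmT.1 (Finset.mem_erase.1 hm).2).1 h1)
      · rintro ⟨h1, h2⟩
        have hk : 1 ≤ k := by omega
        refine ⟨hk, le_antisymm ((hgc k l hk).2 h2) ?_⟩
        by_contra! h
        have h3 : N (lam k) ≤ ∑ x ∈ (T l).erase l, d x :=
          Finset.sum_le_sum_of_subset fun x hx => Finset.mem_erase.2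
            ⟨((hmT.1 hx).1.trans_lt h).ne, hmT.2 ⟨(hmT.1 hx).1.trans h.le, (hmT.1 hx).2⟩⟩
        exact absurd ((hlam k hk).1.trans h3) (not_le.2 h1)
    rw [hset, Set.ncard_coe_finset, Nat.card_Ioc]
    omega

end Enumeration

/-! ### The Sobolev space `H¹` of an interval and its compact embeddings. -/

section EdgeSobolev

/-- The Sobolev space `H¹(0, ℓ)`: a function is given by its value at `0` and its derivative. -/
abbrev EdgeSobolev (ℓ : ℝ) : Type :=
  WithLp 2 (ℝ × Lp ℝ 2 ((volume : Measure ℝ).restrict (Ioc 0 ℓ)))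

namespace EdgeSobolev

variable {ℓ : ℝ}

/-- The function on `[0, ℓ]` given by an element of `H¹(0, ℓ)`. -/
noncomputable def val (u : EdgeSobolev ℓ) (x : ℝ) : ℝ := u.fst + ∫ t in (0 : ℝ)..x, u.snd t

@[simp]
theorem val_zero_right (u : EdgeSobolev ℓ) : u.val 0 = u.fst := by simp [val]

theorem integrableOn_snd (u : EdgeSobolev ℓ) : IntegrableOn u.snd (Ioc 0 ℓ) :=
  (Lp.memLp u.snd).integrable one_le_two

theorem intervalIntegrable_snd (u : EdgeSobolev ℓ) {x y : ℝ} (hx : x ∈ Icc 0 ℓ)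
    (hy : y ∈ Icc 0 ℓ) : IntervalIntegrable u.snd volume x y :=
  ⟨u.integrableOn_snd.mono_set (Ioc_subset_Ioc hx.1 hy.2),
    u.integrableOn_snd.mono_set (Ioc_subset_Ioc hy.1 hx.2)⟩

theorem val_sub_val (u : EdgeSobolev ℓ) {x y : ℝ} (hx : x ∈ Icc 0 ℓ) (hy : y ∈ Icc 0 ℓ) :
    u.val y - u.val x = ∫ t in x..y, u.snd t := by
  have h0 : (0 : ℝ) ∈ Icc 0 ℓ := ⟨le_rfl, hx.1.trans hx.2⟩
  rw [val, val, add_sub_add_left_eq_sub, intervalIntegral.integral_interval_sub_left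
    (u.intervalIntegrable_snd h0 hy) (u.intervalIntegrable_snd h0 hx)]

theorem intervalIntegral_congr_ae {f g : ℝ → ℝ}
    (h : f =ᵐ[(volume : Measure ℝ).restrict (Ioc 0 ℓ)] g) {x y : ℝ}
    (hx : x ∈ Icc 0 ℓ) (hy : y ∈ Icc 0 ℓ) : ∫ t in x..y, f t = ∫ t in x..y, g t := by
  rw [Filter.EventuallyEq, ae_restrict_iff' measurableSet_Ioc] at h
  refine intervalIntegral.integral_congr_ae (h.mono fun t ht hxy => ht ?_)
  rcases le_total x y with hle | hle
  · rw [uIoc_of_le hle] at hxy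
    exact ⟨hx.1.trans_lt hxy.1, hxy.2.trans hy.2⟩
  · rw [uIoc_of_ge hle] at hxy
    exact ⟨hy.1.trans_lt hxy.1, hxy.2.trans hx.2⟩

theorem val_add (u v : EdgeSobolev ℓ) {x : ℝ} (hx : x ∈ Icc 0 ℓ) :
    (u + v).val x = u.val x + v.val x := by
  have h0 : (0 : ℝ) ∈ Icc 0 ℓ := ⟨le_rfl, hx.1.trans hx.2⟩
  simp only [val]
  rw [WithLp.add_fst, WithLp.add_snd, intervalIntegral_congr_ae (Lp.coeFn_add u.snd v.snd) h0 hx]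
  simp only [Pi.add_apply]
  rw [intervalIntegral.integral_add (u.intervalIntegrable_snd h0 hx)
    (v.intervalIntegrable_snd h0 hx)]
  ring

theorem val_smul (c : ℝ) (u : EdgeSobolev ℓ) {x : ℝ} (hx : x ∈ Icc 0 ℓ) :
    (c • u).val x = c * u.val x := by
  have h0 : (0 : ℝ) ∈ Icc 0 ℓ := ⟨le_rfl, hx.1.trans hx.2⟩
  simp only [val]
  rw [WithLp.smul_fst, WithLp.smul_snd, intervalIntegral_congr_ae (Lp.coeFn_smul c u.snd) h0 hx]
  simp only [Pi.smul_apply, smul_eq_mul]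
  rw [intervalIntegral.integral_const_mul, mul_add]

theorem inner_eq (u v : EdgeSobolev ℓ) :
    inner ℝ u v = u.fst * v.fst + ∫ x in Ioc 0 ℓ, u.snd x * v.snd x := by
  rw [WithLp.prod_inner_apply, L2.inner_def]
  simp [mul_comm]

theorem norm_fst_le (u : EdgeSobolev ℓ) : |u.fst| ≤ ‖u‖ := by
  have := WithLp.prod_norm_sq_eq_of_L2 u
  rw [← Real.norm_eq_abs]
  exact abs_le_of_sq_le_sq' (by nlinarith [sq_nonneg ‖u.snd‖]) (norm_nonneg _) |>.2

theorem norm_snd_le (u : EdgeSobolev ℓ) : ‖u.snd‖ ≤ ‖u‖ := by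
  have := WithLp.prod_norm_sq_eq_of_L2 u
  exact abs_le_of_sq_le_sq' (by nlinarith [sq_nonneg ‖u.fst‖]) (norm_nonneg _) |>.2

/-- Cauchy–Schwarz for the derivative against the indicator of `(x, y]`. This Hölder bound supplies
the equicontinuity behind the compact embedding. -/
theorem abs_val_sub_val_le (u : EdgeSobolev ℓ) {x y : ℝ} (hx : x ∈ Icc 0 ℓ) (hy : y ∈ Icc 0 ℓ) :
    |u.val y - u.val x| ≤ √|y - x| * ‖u‖ := by
  wlog hxy : x ≤ y generalizing x y
  · rw [abs_sub_comm, abs_sub_comm y x]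
    exact this hy hx (le_of_not_ge hxy)
  rw [u.val_sub_val hx hy, intervalIntegral.integral_of_le hxy]
  have hsub : Ioc x y ⊆ Ioc 0 ℓ := Ioc_subset_Ioc hx.1 hy.2
  have hfin : (volume.restrict (Ioc 0 ℓ)) (Ioc x y) ≠ ⊤ := by
    rw [Measure.restrict_apply measurableSet_Ioc]
    exact ((measure_mono inter_subset_left).trans_lt measure_Ioc_lt_top).ne
  have h1 : ∫ t in Ioc x y, u.snd t =
      inner ℝ (indicatorConstLp 2 measurableSet_Ioc hfin (1 : ℝ)) u.snd := by
    rw [L2.inner_indicatorConstLp_one measurableSet_Ioc hfin u.snd,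
      Measure.restrict_restrict measurableSet_Ioc, inter_eq_self_of_subset_left hsub]
  have h2 : ‖indicatorConstLp 2 measurableSet_Ioc hfin (1 : ℝ)‖ = √|y - x| := by
    rw [norm_indicatorConstLp two_ne_zero ENNReal.ofNat_ne_top, measureReal_restrict_apply
      measurableSet_Ioc, inter_eq_self_of_subset_left hsub, Real.volume_real_Ioc_of_le hxy,
      abs_of_nonneg (sub_nonneg.2 hxy), Real.sqrt_eq_rpow]
    simp
  rw [h1, ← Real.norm_eq_abs, ← h2]
  exact (norm_inner_le_norm _ _).trans (by gcongr; exact u.norm_snd_le)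

theorem abs_val_le (u : EdgeSobolev ℓ) {x : ℝ} (hx : x ∈ Icc 0 ℓ) :
    |u.val x| ≤ (1 + √ℓ) * ‖u‖ := by
  have h0 : (0 : ℝ) ∈ Icc 0 ℓ := ⟨le_rfl, hx.1.trans hx.2⟩
  have h1 := u.abs_val_sub_val_le h0 hx
  have h2 : √|x - 0| ≤ √ℓ := Real.sqrt_le_sqrt (by rw [sub_zero, abs_of_nonneg hx.1]; exact hx.2)
  have h3 := u.norm_fst_le
  have h4 : |u.val x| ≤ |u.val x - u.val 0| + |u.val 0| := by
    simpa using abs_add_le (u.val x - u.val 0) (u.val 0)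
  rw [val_zero_right] at h1 h4
  nlinarith [norm_nonneg u]

theorem absolutelyContinuous_val (u : EdgeSobolev ℓ) (hℓ : 0 ≤ ℓ) :
    AbsolutelyContinuousOnInterval u.val 0 ℓ := by
  have h := (u.intervalIntegrable_snd (left_mem_Icc.2 hℓ)
    (right_mem_Icc.2 hℓ)).absolutelyContinuousOnInterval_intervalIntegral
    (c := 0) left_mem_uIcc
  have hc : AbsolutelyContinuousOnInterval (fun _ : ℝ => u.fst) 0 ℓ :=
    (LipschitzWith.const u.fst).lipschitzOnWith.absolutelyContinuousOnInterval
  exact hc.add h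

theorem continuousOn_val (u : EdgeSobolev ℓ) : ContinuousOn u.val (Icc 0 ℓ) := by
  rcases le_or_gt 0 ℓ with hℓ | hℓ
  · have := (u.absolutelyContinuous_val hℓ).continuousOn
    rwa [uIcc_of_le hℓ] at this
  · simp [Icc_eq_empty_of_lt hℓ]

theorem ae_hasDerivAt_val (u : EdgeSobolev ℓ) :
    ∀ᵐ x, x ∈ Icc 0 ℓ → HasDerivAt u.val (u.snd x) x := by
  rcases le_or_gt 0 ℓ with hℓ | hℓ
  · filter_upwards [(u.intervalIntegrable_snd (left_mem_Icc.2 hℓ)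
      (right_mem_Icc.2 hℓ)).ae_hasDerivAt_integral] with x hx hxI
    rw [uIcc_of_le hℓ] at hx
    exact (hx hxI 0 (left_mem_Icc.2 hℓ)).const_add u.fst
  · simp [Icc_eq_empty_of_lt hℓ]

/-- An averaging estimate: the supremum is controlled by the `L²` norm, up to a small multiple
of the Sobolev norm. -/
theorem sq_val_le (u : EdgeSobolev ℓ) {δ : ℝ} (hδ : 0 < δ) (hδℓ : δ ≤ ℓ) {x : ℝ}
    (hx : x ∈ Icc 0 ℓ) :
    u.val x ^ 2 ≤ 2 * δ * ‖u‖ ^ 2 + 2 / δ * ∫ y in (0 : ℝ)..ℓ, u.val y ^ 2 := by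
  -- A window of width `δ` inside `[0, ℓ]` that contains `x`. The pointwise estimate is averaged
  -- over it.
  obtain ⟨s, hs0, hsℓ, hsx, hxs⟩ : ∃ s, 0 ≤ s ∧ s + δ ≤ ℓ ∧ s ≤ x ∧ x ≤ s + δ := by
    refine ⟨max 0 (x - δ), le_max_left _ _, ?_, max_le hx.1 (by linarith), ?_⟩
    · rcases max_cases 0 (x - δ) with h | h <;> linarith [hx.2]
    · linarith [le_max_right 0 (x - δ)]
  have hint : IntervalIntegrable (fun y => u.val y ^ 2) volume 0 ℓ :=
    (u.continuousOn_val.pow 2).intervalIntegrable_of_Icc (hδ.le.trans hδℓ)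
  have hsub : Icc s (s + δ) ⊆ Icc 0 ℓ := Icc_subset_Icc hs0 hsℓ
  have hint' : IntervalIntegrable (fun y => u.val y ^ 2) volume s (s + δ) :=
    ((u.continuousOn_val.mono hsub).pow 2).intervalIntegrable_of_Icc (by linarith)
  have h1 : ∫ _y in s..(s + δ), u.val x ^ 2 ≤
      ∫ y in s..(s + δ), (2 * δ * ‖u‖ ^ 2 + 2 * u.val y ^ 2) := by
    refine intervalIntegral.integral_mono_on (by linarith) intervalIntegrable_const
      (intervalIntegrable_const.add (hint'.const_mul 2)) fun y hy => ?_
    have h2 := u.abs_val_sub_val_le (hsub hy) hx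
    have h3 : |u.val x - u.val y| ^ 2 ≤ δ * ‖u‖ ^ 2 := by
      have h4 : |x - y| ≤ δ := by rw [abs_le]; constructor <;> linarith [hy.1, hy.2]
      calc |u.val x - u.val y| ^ 2 ≤ (√|x - y| * ‖u‖) ^ 2 := by gcongr
        _ = |x - y| * ‖u‖ ^ 2 := by rw [mul_pow, Real.sq_sqrt (abs_nonneg _)]
        _ ≤ _ := by gcongr
    rw [sq_abs] at h3
    -- This square is the difference of the two sides of `A² ≤ 2 (A - B)² + 2 B²` for `A = u.val x`,
    -- `B = u.val y`.
    nlinarith [sq_nonneg (u.val x - 2 * u.val y)]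
  have h5 : ∫ y in s..(s + δ), u.val y ^ 2 ≤ ∫ y in (0 : ℝ)..ℓ, u.val y ^ 2 :=
    intervalIntegral.integral_mono_interval hs0 (by linarith) hsℓ
      (Eventually.of_forall fun y => sq_nonneg _) hint
  rw [intervalIntegral.integral_add intervalIntegrable_const (hint'.const_mul 2),
    intervalIntegral.integral_const, intervalIntegral.integral_const,
    intervalIntegral.integral_const_mul, add_sub_cancel_left, smul_eq_mul, smul_eq_mul] at h1
  have h6 : u.val x ^ 2 ≤ (δ * (2 * δ * ‖u‖ ^ 2) + 2 * ∫ y in (0 : ℝ)..ℓ, u.val y ^ 2) / δ := by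
    rw [le_div_iff₀ hδ]
    linarith
  refine h6.trans_eq ?_
  field_simp

/-- The embedding of `H¹(0, ℓ)` into the bounded continuous functions on `[0, ℓ]`. -/
noncomputable def toBCF (ℓ : ℝ) : EdgeSobolev ℓ →L[ℝ] BoundedContinuousFunction (Icc 0 ℓ) ℝ :=
  LinearMap.mkContinuous
    { toFun := fun u => BoundedContinuousFunction.mkOfCompact
        ⟨fun x : Icc 0 ℓ => u.val x, u.continuousOn_val.domRestrict⟩
      map_add' := fun u v => by
        ext x
        exact u.val_add v x.2
      map_smul' := fun c u => by
        ext x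
        exact u.val_smul c x.2 }
    (1 + √ℓ)
    fun u => (BoundedContinuousFunction.norm_le (by positivity)).2 fun x => u.abs_val_le x.2

theorem toBCF_apply (u : EdgeSobolev ℓ) (x : Icc 0 ℓ) : toBCF ℓ u x = u.val x := rfl

/-- The unit ball is uniformly bounded and uniformly Hölder of exponent `1/2`, so Arzelà–Ascoli
applies. -/
theorem isCompactOperator_toBCF (ℓ : ℝ) : IsCompactOperator (toBCF ℓ) := by
  have : IsCompactOperator ((toBCF ℓ : EdgeSobolev ℓ →ₗ[ℝ]
      BoundedContinuousFunction (Icc 0 ℓ) ℝ)) := by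
    rw [isCompactOperator_iff_isCompact_closure_image_closedBall _ one_pos]
    refine BoundedContinuousFunction.arzela_ascoli (Metric.closedBall 0 (1 + √ℓ))
      (isCompact_closedBall _ _) _ ?_ ?_
    · rintro _ x ⟨u, hu, rfl⟩
      rw [mem_closedBall_zero_iff] at hu ⊢
      calc |u.val x| ≤ (1 + √ℓ) * ‖u‖ := u.abs_val_le x.2
        _ ≤ (1 + √ℓ) * 1 := by gcongr
        _ = _ := mul_one _
    · refine Metric.equicontinuous_of_continuity_modulus (fun r => √r) ?_ _ ?_
      · simpa using (Real.continuous_sqrt.tendsto 0)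
      · rintro x y ⟨_, u, hu, rfl⟩
        rw [mem_closedBall_zero_iff] at hu
        rw [dist_comm, Real.dist_eq, Subtype.dist_eq, dist_comm, Real.dist_eq]
        calc |u.val y - u.val x| ≤ √|(y : ℝ) - x| * ‖u‖ := u.abs_val_sub_val_le x.2 y.2
          _ ≤ √|(y : ℝ) - x| * 1 := by gcongr
          _ = _ := mul_one _
  exact this

/-- The Lebesgue measure on the interval `[0, ℓ]`. -/
noncomputable abbrev edgeVolume (ℓ : ℝ) : Measure (Icc 0 ℓ) :=
  (volume : Measure ℝ).comap Subtype.val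

instance (ℓ : ℝ) : IsFiniteMeasure (edgeVolume ℓ) where
  measure_univ_lt_top := by
    rw [comap_subtype_coe_apply measurableSet_Icc, image_univ, Subtype.range_coe]
    exact measure_Icc_lt_top

/-- The embedding of `H¹(0, ℓ)` into `L²(0, ℓ)`. -/
noncomputable def toL2 (ℓ : ℝ) : EdgeSobolev ℓ →L[ℝ] Lp ℝ 2 (edgeVolume ℓ) :=
  (BoundedContinuousFunction.toLp 2 (edgeVolume ℓ) ℝ).comp (toBCF ℓ)

theorem isCompactOperator_toL2 (ℓ : ℝ) : IsCompactOperator (toL2 ℓ) :=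
  (isCompactOperator_toBCF ℓ).clm_comp (BoundedContinuousFunction.toLp 2 (edgeVolume ℓ) ℝ)

theorem inner_toL2 (hℓ : 0 ≤ ℓ) (u v : EdgeSobolev ℓ) :
    inner ℝ (toL2 ℓ u) (toL2 ℓ v) = ∫ x in (0 : ℝ)..ℓ, u.val x * v.val x := by
  have h := BoundedContinuousFunction.inner_toLp (𝕜 := ℝ) (edgeVolume ℓ)
    (toBCF ℓ u) (toBCF ℓ v)
  refine h.trans ?_
  simp only [toBCF_apply, conj_trivial]
  rw [intervalIntegral.integral_of_le hℓ, ← integral_Icc_eq_integral_Ioc,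
    ← integral_subtype_comap measurableSet_Icc fun x => u.val x * v.val x]
  simp only [mul_comm]

theorem ext_of_val (hℓ : 0 < ℓ) {u v : EdgeSobolev ℓ} (h : ∀ x ∈ Icc 0 ℓ, u.val x = v.val x) :
    u = v := by
  refine WithLp.ofLp_injective 2 (Prod.ext ?_ ?_)
  · have := h 0 (left_mem_Icc.2 hℓ.le)
    simpa using this
  · refine Lp.ext ?_
    rw [Filter.EventuallyEq, ae_restrict_iff' measurableSet_Ioc]
    filter_upwards [u.ae_hasDerivAt_val, v.ae_hasDerivAt_val, Measure.ae_ne volume ℓ]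
      with x hu hv hxℓ hx
    have hx' : x ∈ Ioo 0 ℓ := ⟨hx.1, lt_of_le_of_ne hx.2 hxℓ⟩
    have hev : u.val =ᶠ[𝓝 x] v.val := by
      filter_upwards [Icc_mem_nhds hx'.1 hx'.2] with y hy using h y hy
    exact (hu (Ioo_subset_Icc_self hx')).unique
      ((hv (Ioo_subset_Icc_self hx')).congr_of_eventuallyEq hev)

theorem toL2_injective (hℓ : 0 < ℓ) : Function.Injective (toL2 ℓ) := by
  rw [injective_iff_map_eq_zero]
  intro u hu
  refine ext_of_val hℓ fun x hx => ?_
  have h1 := inner_toL2 hℓ.le u u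
  rw [hu, inner_zero_left] at h1
  have hz : (0 : EdgeSobolev ℓ).val x = 0 := by simpa using val_smul 0 (0 : EdgeSobolev ℓ) hx
  rw [hz]
  by_contra hne
  have h2 : 0 < ∫ x in (0 : ℝ)..ℓ, u.val x * u.val x :=
    intervalIntegral.integral_pos hℓ (u.continuousOn_val.mul u.continuousOn_val)
      (fun y _ => mul_self_nonneg _) ⟨x, hx, mul_self_pos.2 hne⟩
  exact h2.ne h1

/-- The element of `H¹(0, ℓ)` with given value at `0` and given derivative. -/
noncomputable def ofDeriv (c : ℝ) (g : ℝ → ℝ)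
    (hg : MemLp g 2 ((volume : Measure ℝ).restrict (Ioc 0 ℓ))) : EdgeSobolev ℓ :=
  WithLp.toLp 2 (c, hg.toLp g)

section OfDeriv

variable {c : ℝ} {g : ℝ → ℝ} (hg : MemLp g 2 ((volume : Measure ℝ).restrict (Ioc 0 ℓ)))

theorem ofDeriv_fst : (ofDeriv c g hg).fst = c := rfl

theorem ofDeriv_snd : (ofDeriv c g hg).snd =ᵐ[(volume : Measure ℝ).restrict (Ioc 0 ℓ)] g :=
  hg.coeFn_toLp

theorem ofDeriv_val {x : ℝ} (hx : x ∈ Icc 0 ℓ) :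
    (ofDeriv c g hg).val x = c + ∫ t in (0 : ℝ)..x, g t := by
  rw [val, ofDeriv_fst, intervalIntegral_congr_ae (ofDeriv_snd hg)
    ⟨le_rfl, hx.1.trans hx.2⟩ hx]

end OfDeriv

end EdgeSobolev

end EdgeSobolev

/-! ### The energy form of one edge: boundedness and semiboundedness. -/

section EdgeEnergy

namespace EdgeSobolev

variable {ℓ : ℝ}

/-- Evaluation at a point of `[0, ℓ]`. -/
noncomputable def evalCLM {x : ℝ} (hx : x ∈ Icc 0 ℓ) : EdgeSobolev ℓ →L[ℝ] ℝ :=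
  (BoundedContinuousFunction.evalCLM ℝ (⟨x, hx⟩ : Icc 0 ℓ)).comp (toBCF ℓ)

theorem continuousOn_val_mul_val (u v : EdgeSobolev ℓ) (hℓ : 0 ≤ ℓ) :
    ContinuousOn (fun x => u.val x * v.val x) (uIcc 0 ℓ) := by
  rw [uIcc_of_le hℓ]
  exact u.continuousOn_val.mul v.continuousOn_val

theorem intervalIntegrable_mul_val {q : ℝ → ℝ} (hq : IntervalIntegrable q volume 0 ℓ)
    (hℓ : 0 ≤ ℓ) (u v : EdgeSobolev ℓ) :
    IntervalIntegrable (fun x => q x * (u.val x * v.val x)) volume 0 ℓ :=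
  hq.mul_continuousOn (continuousOn_val_mul_val u v hℓ)

/-- The energy form `∫ u' v' + ∫ q u v` of one edge. -/
noncomputable def energy {q : ℝ → ℝ} (hℓ : 0 ≤ ℓ) (hq : IntervalIntegrable q volume 0 ℓ) :
    EdgeSobolev ℓ →ₗ[ℝ] EdgeSobolev ℓ →ₗ[ℝ] ℝ :=
  LinearMap.mk₂ ℝ
    (fun u v => inner ℝ u v - u.fst * v.fst + ∫ x in (0 : ℝ)..ℓ, q x * (u.val x * v.val x))
    (fun u₁ u₂ v => by
      have h : ∫ x in (0 : ℝ)..ℓ, q x * ((u₁ + u₂).val x * v.val x) =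
          ∫ x in (0 : ℝ)..ℓ, (q x * (u₁.val x * v.val x) + q x * (u₂.val x * v.val x)) := by
        refine intervalIntegral.integral_congr fun x hx => ?_
        rw [uIcc_of_le hℓ] at hx
        simp only [val_add u₁ u₂ hx]
        ring
      rw [h, intervalIntegral.integral_add (intervalIntegrable_mul_val hq hℓ u₁ v)
        (intervalIntegrable_mul_val hq hℓ u₂ v), inner_add_left, WithLp.add_fst]
      ring)
    (fun c u v => by
      have h : ∫ x in (0 : ℝ)..ℓ, q x * ((c • u).val x * v.val x) =
          ∫ x in (0 : ℝ)..ℓ, c * (q x * (u.val x * v.val x)) := by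
        refine intervalIntegral.integral_congr fun x hx => ?_
        rw [uIcc_of_le hℓ] at hx
        simp only [val_smul c u hx]
        ring
      rw [h, intervalIntegral.integral_const_mul, inner_smul_left, WithLp.smul_fst]
      simp only [conj_trivial, smul_eq_mul]
      ring)
    (fun u v₁ v₂ => by
      have h : ∫ x in (0 : ℝ)..ℓ, q x * (u.val x * (v₁ + v₂).val x) =
          ∫ x in (0 : ℝ)..ℓ, (q x * (u.val x * v₁.val x) + q x * (u.val x * v₂.val x)) := by
        refine intervalIntegral.integral_congr fun x hx => ?_
        rw [uIcc_of_le hℓ] at hx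
        simp only [val_add v₁ v₂ hx]
        ring
      rw [h, intervalIntegral.integral_add (intervalIntegrable_mul_val hq hℓ u v₁)
        (intervalIntegrable_mul_val hq hℓ u v₂), inner_add_right, WithLp.add_fst]
      ring)
    (fun c u v => by
      have h : ∫ x in (0 : ℝ)..ℓ, q x * (u.val x * (c • v).val x) =
          ∫ x in (0 : ℝ)..ℓ, c * (q x * (u.val x * v.val x)) := by
        refine intervalIntegral.integral_congr fun x hx => ?_
        rw [uIcc_of_le hℓ] at hx
        simp only [val_smul c v hx]
        ring
      rw [h, intervalIntegral.integral_const_mul, inner_smul_right, WithLp.smul_fst]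
      simp only [smul_eq_mul]
      ring)

section Energy

variable {q : ℝ → ℝ} (hℓ : 0 ≤ ℓ) (hq : IntervalIntegrable q volume 0 ℓ)

theorem energy_apply (u v : EdgeSobolev ℓ) : energy hℓ hq u v =
    (∫ x in Ioc 0 ℓ, u.snd x * v.snd x) + ∫ x in (0 : ℝ)..ℓ, q x * (u.val x * v.val x) := by
  change inner ℝ u v - u.fst * v.fst + _ = _
  rw [inner_eq]
  ring

theorem energy_comm (u v : EdgeSobolev ℓ) : energy hℓ hq u v = energy hℓ hq v u := by
  simp only [energy_apply, mul_comm]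

theorem abs_integral_mul_val_le (hℓ : 0 ≤ ℓ) (hq : IntervalIntegrable q volume 0 ℓ)
    {A B : ℝ} (hA : 0 ≤ A) {u v : EdgeSobolev ℓ}
    (hu : ∀ x ∈ Icc 0 ℓ, |u.val x| ≤ A) (hv : ∀ x ∈ Icc 0 ℓ, |v.val x| ≤ B) :
    |∫ x in (0 : ℝ)..ℓ, q x * (u.val x * v.val x)| ≤ (∫ x in (0 : ℝ)..ℓ, |q x|) * (A * B) := by
  rw [← intervalIntegral.integral_mul_const, ← Real.norm_eq_abs]
  refine intervalIntegral.norm_integral_le_of_norm_le hℓ (Eventually.of_forall fun x hx => ?_)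
    (hq.abs.mul_const _)
  have hx' := Ioc_subset_Icc_self hx
  rw [Real.norm_eq_abs, abs_mul, abs_mul]
  gcongr
  · exact hu x hx'
  · exact hv x hx'

theorem exists_energy_bound :
    ∃ M, 0 ≤ M ∧ ∀ u v : EdgeSobolev ℓ, |energy hℓ hq u v| ≤ M * (‖u‖ * ‖v‖) := by
  have hq0 : 0 ≤ ∫ x in (0 : ℝ)..ℓ, |q x| :=
    intervalIntegral.integral_nonneg hℓ fun x _ => abs_nonneg _
  refine ⟨2 + (∫ x in (0 : ℝ)..ℓ, |q x|) * (1 + √ℓ) ^ 2, by positivity, fun u v => ?_⟩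
  have h1 : |∫ x in (0 : ℝ)..ℓ, q x * (u.val x * v.val x)| ≤ (∫ x in (0 : ℝ)..ℓ, |q x|) *
      (((1 + √ℓ) * ‖u‖) * ((1 + √ℓ) * ‖v‖)) :=
    abs_integral_mul_val_le hℓ hq (by positivity) (fun x hx => u.abs_val_le hx)
      (fun x hx => v.abs_val_le hx)
  have h2 : |inner ℝ u v| ≤ ‖u‖ * ‖v‖ := abs_real_inner_le_norm u v
  have h3 : |u.fst * v.fst| ≤ ‖u‖ * ‖v‖ := by
    rw [abs_mul]
    gcongr
    · exact u.norm_fst_le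
    · exact v.norm_fst_le
  calc |inner ℝ u v - u.fst * v.fst + ∫ x in (0 : ℝ)..ℓ, q x * (u.val x * v.val x)|
      ≤ |inner ℝ u v| + |u.fst * v.fst| + |∫ x in (0 : ℝ)..ℓ, q x * (u.val x * v.val x)| :=
        (abs_add_le _ _).trans (by gcongr; exact abs_sub _ _)
    _ ≤ ‖u‖ * ‖v‖ + ‖u‖ * ‖v‖ + (∫ x in (0 : ℝ)..ℓ, |q x|) *
      (((1 + √ℓ) * ‖u‖) * ((1 + √ℓ) * ‖v‖)) := by gcongr
    _ = _ := by ring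

/-- The energy form of an edge with additional point interactions at the ends is semibounded. -/
theorem exists_energy_coercive (hℓ' : 0 < ℓ) (b₀ b₁ : ℝ) :
    ∃ C, 0 ≤ C ∧ ∀ u : EdgeSobolev ℓ, 1 / 2 * ‖u‖ ^ 2 ≤
      energy hℓ hq u u + b₀ * u.val 0 ^ 2 + b₁ * u.val ℓ ^ 2
        + C * ∫ x in (0 : ℝ)..ℓ, u.val x * u.val x := by
  have hq0 : 0 ≤ ∫ x in (0 : ℝ)..ℓ, |q x| :=
    intervalIntegral.integral_nonneg hℓ fun x _ => abs_nonneg _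
  set Q := ∫ x in (0 : ℝ)..ℓ, |q x|
  -- `m` counts the multiples of `sup u²` to be absorbed: one for the term `u.fst ^ 2` absent from
  -- the energy, `Q` for the potential, the rest for the ends. The choice `δ ≤ 1 / (4 m)` makes this
  -- cost at most half of `‖u‖²`.
  set m : ℝ := 1 + Q + |b₀| + |b₁| with hm
  have hm0 : 0 < m := by positivity
  set δ : ℝ := min ℓ (1 / (4 * m))
  have hδ0 : 0 < δ := lt_min hℓ' (by positivity)
  have hδm : δ * (4 * m) ≤ 1 := by
    rw [← le_div_iff₀ (by positivity)]
    exact min_le_right _ _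
  refine ⟨2 * m / δ, by positivity, fun u => ?_⟩
  set I := ∫ x in (0 : ℝ)..ℓ, u.val x * u.val x with hI
  have hI' : ∫ x in (0 : ℝ)..ℓ, u.val x ^ 2 = I := by simp only [hI, sq]
  have hI0 : 0 ≤ I := intervalIntegral.integral_nonneg hℓ fun x _ => mul_self_nonneg _
  set S : ℝ := 2 * δ * ‖u‖ ^ 2 + 2 / δ * I with hS
  have hS0 : 0 ≤ S := by positivity
  have hval : ∀ x ∈ Icc 0 ℓ, u.val x ^ 2 ≤ S := fun x hx => by
    have := u.sq_val_le hδ0 (min_le_left _ _) hx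
    rwa [hI'] at this
  have habs : ∀ x ∈ Icc 0 ℓ, |u.val x| ≤ √S := fun x hx => Real.abs_le_sqrt (hval x hx)
  have h1 := abs_integral_mul_val_le hℓ hq (Real.sqrt_nonneg S) habs habs
  rw [Real.mul_self_sqrt hS0] at h1
  have h2 := (abs_le.1 h1).1
  have h3 : -(|b₀| * S) ≤ b₀ * u.val 0 ^ 2 := by
    have := hval 0 (left_mem_Icc.2 hℓ)
    nlinarith [neg_abs_le b₀, sq_nonneg (u.val 0), abs_nonneg b₀]
  have h4 : -(|b₁| * S) ≤ b₁ * u.val ℓ ^ 2 := by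
    have := hval ℓ (right_mem_Icc.2 hℓ)
    nlinarith [neg_abs_le b₁, sq_nonneg (u.val ℓ), abs_nonneg b₁]
  have h5 : energy hℓ hq u u = ‖u‖ ^ 2 - u.fst ^ 2 +
      ∫ x in (0 : ℝ)..ℓ, q x * (u.val x * u.val x) := by
    rw [← real_inner_self_eq_norm_sq, sq]
    rfl
  have h6 : u.fst ^ 2 ≤ S := by
    have := hval 0 (left_mem_Icc.2 hℓ)
    rwa [val_zero_right] at this
  have h7 : m * S = (δ * (4 * m)) * (1 / 2) * ‖u‖ ^ 2 + 2 * m / δ * I := by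
    rw [hS]
    ring
  have h8 : (δ * (4 * m)) * (1 / 2) * ‖u‖ ^ 2 ≤ 1 * (1 / 2) * ‖u‖ ^ 2 := by gcongr
  have h9 : m * S = S + Q * S + |b₀| * S + |b₁| * S := by rw [hm]; ring
  rw [h5]
  linarith

end Energy

end EdgeSobolev

end EdgeEnergy

/-! ### The form domain and the quadratic form on the graph. -/

namespace MetricGraph

section FormDomain

variable {V E : Type*} (Γ : MetricGraph V E)

/-- The Sobolev space `⨁ₑ H¹(0, ℓₑ)` on the disjoint union of the edges. -/
abbrev Broken : Type _ := PiLp 2 fun e => EdgeSobolev (Γ.length e)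

/-- The Lebesgue space `⨁ₑ L²(0, ℓₑ)`. -/
abbrev BrokenL2 : Type _ := PiLp 2 fun e => Lp ℝ 2 (EdgeSobolev.edgeVolume (Γ.length e))

/-- The position of an edge end. -/
def endPos : E × Bool → ℝ
  | (_, false) => 0
  | (e, true) => Γ.length e

theorem endPos_mem (s : E × Bool) : Γ.endPos s ∈ Icc 0 (Γ.length s.1) := by
  obtain ⟨e, b⟩ := s
  cases b
  · exact left_mem_Icc.2 (Γ.length_pos e).le
  · exact right_mem_Icc.2 (Γ.length_pos e).le

theorem edge_endPos (s : E × Bool) : Γ.edge s.1 (Γ.endPos s) = Γ.vertex (Γ.vertexOf s) := by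
  obtain ⟨e, b⟩ := s
  cases b
  · exact Γ.edge_zero e
  · exact Γ.edge_length e

theorem edge_of_mem {e : E} {x : ℝ} (hx : x ∈ Icc 0 (Γ.length e)) :
    Γ.edge e x = Quot.mk _ ⟨e, x, hx⟩ := by
  rw [edge, projIcc_of_mem _ hx]

/-- The value at an edge end. -/
noncomputable def endVal (s : E × Bool) : Γ.Broken →L[ℝ] ℝ :=
  (EdgeSobolev.evalCLM (Γ.endPos_mem s)).comp (PiLp.proj 2 _ s.1)

theorem endVal_apply (s : E × Bool) (u : Γ.Broken) : Γ.endVal s u = (u s.1).val (Γ.endPos s) :=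
  rfl

/-- The embedding of the broken Sobolev space into `L²`. -/
noncomputable def brokenToL2 : Γ.Broken →L[ℝ] Γ.BrokenL2 :=
  (PiLp.continuousLinearEquiv 2 ℝ
    fun e => Lp ℝ 2 (EdgeSobolev.edgeVolume (Γ.length e))).symm.toContinuousLinearMap.comp
    (ContinuousLinearMap.pi fun e => (EdgeSobolev.toL2 (Γ.length e)).comp (PiLp.proj 2 _ e))

theorem brokenToL2_apply (u : Γ.Broken) (e : E) :
    Γ.brokenToL2 u e = EdgeSobolev.toL2 (Γ.length e) (u e) := rfl

theorem brokenToL2_injective : Function.Injective Γ.brokenToL2 := by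
  intro u v h
  ext1 e
  exact EdgeSobolev.toL2_injective (Γ.length_pos e) (congrArg (fun w : Γ.BrokenL2 => w e) h)

/-- The form domain: the functions of the broken Sobolev space that are continuous at the
vertices and vanish at the vertices with Dirichlet condition. -/
noncomputable def formDomain (α : V → WithTop ℝ) : Submodule ℝ Γ.Broken where
  carrier := {u | (∀ s t, Γ.vertexOf s = Γ.vertexOf t → Γ.endVal s u = Γ.endVal t u) ∧
    ∀ s, α (Γ.vertexOf s) = ⊤ → Γ.endVal s u = 0}
  add_mem' {u v} hu hv := ⟨fun s t h => by rw [map_add, map_add, hu.1 s t h, hv.1 s t h],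
    fun s h => by rw [map_add, hu.2 s h, hv.2 s h, add_zero]⟩
  zero_mem' := ⟨fun s t _ => by simp, fun s _ => by simp⟩
  smul_mem' c u hu := ⟨fun s t h => by rw [map_smul, map_smul, hu.1 s t h],
    fun s h => by rw [map_smul, hu.2 s h, smul_zero]⟩

theorem mem_formDomain {α : V → WithTop ℝ} {u : Γ.Broken} : u ∈ Γ.formDomain α ↔
    (∀ s t, Γ.vertexOf s = Γ.vertexOf t → Γ.endVal s u = Γ.endVal t u) ∧
      ∀ s, α (Γ.vertexOf s) = ⊤ → Γ.endVal s u = 0 := Iff.rfl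

/-- The embedding of the form domain into `L²`. -/
noncomputable def formToL2 (α : V → WithTop ℝ) : Γ.formDomain α →L[ℝ] Γ.BrokenL2 :=
  Γ.brokenToL2.comp (Γ.formDomain α).subtypeL

theorem formToL2_apply (α : V → WithTop ℝ) (u : Γ.formDomain α) :
    Γ.formToL2 α u = Γ.brokenToL2 u := rfl

theorem isClosed_formDomain (α : V → WithTop ℝ) : IsClosed (Γ.formDomain α : Set Γ.Broken) := by
  have : (Γ.formDomain α : Set Γ.Broken) =
      (⋂ s, ⋂ t, ⋂ (_ : Γ.vertexOf s = Γ.vertexOf t), {u | Γ.endVal s u = Γ.endVal t u}) ∩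
        ⋂ s, ⋂ (_ : α (Γ.vertexOf s) = ⊤), {u | Γ.endVal s u = 0} := by
    ext u
    simp [mem_formDomain]
  rw [this]
  refine IsClosed.inter ?_ ?_
  · exact isClosed_iInter fun s => isClosed_iInter fun t => isClosed_iInter fun _ =>
      isClosed_eq (Γ.endVal s).continuous (Γ.endVal t).continuous
  · exact isClosed_iInter fun s => isClosed_iInter fun _ =>
      isClosed_eq (Γ.endVal s).continuous continuous_const

variable [Fintype E]

theorem inner_brokenToL2 (u v : Γ.Broken) : inner ℝ (Γ.brokenToL2 u) (Γ.brokenToL2 v) =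
    ∑ e, ∫ x in (0 : ℝ)..Γ.length e, (u e).val x * (v e).val x := by
  rw [PiLp.inner_apply]
  exact Finset.sum_congr rfl fun e _ => EdgeSobolev.inner_toL2 (Γ.length_pos e).le _ _

theorem isCompactOperator_brokenToL2 : IsCompactOperator Γ.brokenToL2 := by
  refine IsCompactOperator.clm_comp (f := ContinuousLinearMap.pi fun e =>
    (EdgeSobolev.toL2 (Γ.length e)).comp
      (PiLp.proj 2 (𝕜 := ℝ) (fun e => EdgeSobolev (Γ.length e)) e)) ?_
    (PiLp.continuousLinearEquiv 2 ℝ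
      fun e => Lp ℝ 2 (EdgeSobolev.edgeVolume (Γ.length e))).symm.toContinuousLinearMap
  have h : ∀ e, IsCompactOperator ((EdgeSobolev.toL2 (Γ.length e)).comp
      (PiLp.proj 2 (𝕜 := ℝ) (fun e => EdgeSobolev (Γ.length e)) e)) := fun e =>
    (EdgeSobolev.isCompactOperator_toL2 _).comp_clm _
  choose K hK hK' using h
  refine ⟨Set.pi univ K, isCompact_univ_pi hK, ?_⟩
  filter_upwards [Filter.iInter_mem.2 hK'] with u hu e _
  exact mem_iInter.1 hu e

instance (α : V → WithTop ℝ) : CompleteSpace (Γ.formDomain α) :=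
  (Γ.isClosed_formDomain α).completeSpace_coe

variable {q : E → ℝ → ℝ} (hq : ∀ e, IntervalIntegrable (q e) volume 0 (Γ.length e))
  (β : E × Bool → ℝ)

/-- The quadratic form of the Schrödinger operator with potential `q` and weights `β` at the edge
ends. -/
noncomputable def brokenForm : Γ.Broken →ₗ[ℝ] Γ.Broken →ₗ[ℝ] ℝ :=
  (∑ e, (EdgeSobolev.energy (Γ.length_pos e).le (hq e)).compl₁₂
      (PiLp.projₗ 2 (𝕜 := ℝ) (fun e => EdgeSobolev (Γ.length e)) e)
      (PiLp.projₗ 2 (𝕜 := ℝ) (fun e => EdgeSobolev (Γ.length e)) e))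
    + ∑ s, β s • (LinearMap.mul ℝ ℝ).compl₁₂ (Γ.endVal s : Γ.Broken →ₗ[ℝ] ℝ)
      (Γ.endVal s : Γ.Broken →ₗ[ℝ] ℝ)

theorem brokenForm_apply (u v : Γ.Broken) : Γ.brokenForm hq β u v =
    (∑ e, EdgeSobolev.energy (Γ.length_pos e).le (hq e) (u e) (v e))
      + ∑ s, β s * (Γ.endVal s u * Γ.endVal s v) := by
  simp [brokenForm, LinearMap.sum_apply]

/-- The quadratic form of the Schrödinger operator on the form domain. -/
noncomputable def form (α : V → WithTop ℝ) :
    Γ.formDomain α →ₗ[ℝ] Γ.formDomain α →ₗ[ℝ] ℝ :=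
  (Γ.brokenForm hq β).compl₁₂ (Γ.formDomain α).subtype (Γ.formDomain α).subtype

theorem form_apply (α : V → WithTop ℝ) (u v : Γ.formDomain α) :
    Γ.form hq β α u v = Γ.brokenForm hq β u v := rfl

theorem sum_edge_ends (F : E × Bool → ℝ) : ∑ s, F s = ∑ e, (F (e, false) + F (e, true)) := by
  rw [Fintype.sum_prod_type]
  refine Finset.sum_congr rfl fun e _ => ?_
  rw [Fintype.sum_bool, add_comm]

/-- Each edge absorbs the weights at its own two ends, so their signs do not matter. The edge
constants may be replaced by their sum because they and the integrals of `u²` are nonnegative. -/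
theorem isSemiboundedForm (α : V → WithTop ℝ) :
    IsSemiboundedForm (V := Γ.formDomain α) (K := Γ.BrokenL2) (Γ.form hq β α) (Γ.formToL2 α) where
  symm u v := by
    simp only [form_apply, brokenForm_apply]
    congr 1
    · exact Finset.sum_congr rfl fun e _ => EdgeSobolev.energy_comm _ _ _ _
    · exact Finset.sum_congr rfl fun s _ => by ring
  bounded := by
    choose M hM0 hM using fun e => EdgeSobolev.exists_energy_bound (Γ.length_pos e).le (hq e)
    refine ⟨∑ e, M e + ∑ s, |β s| * (‖Γ.endVal s‖ * ‖Γ.endVal s‖), fun u v => ?_⟩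
    rw [form_apply, brokenForm_apply, mul_assoc, add_mul, Finset.sum_mul, Finset.sum_mul]
    refine (norm_add_le _ _).trans (add_le_add ?_ ?_)
    · refine (norm_sum_le _ _).trans (Finset.sum_le_sum fun e _ => ?_)
      rw [Real.norm_eq_abs]
      refine (hM e _ _).trans ?_
      have := hM0 e
      gcongr
      · exact PiLp.norm_apply_le (u : Γ.Broken) e
      · exact PiLp.norm_apply_le (v : Γ.Broken) e
    · refine (norm_sum_le _ _).trans (Finset.sum_le_sum fun s _ => ?_)
      rw [norm_mul, norm_mul, Real.norm_eq_abs (β s), mul_assoc]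
      calc |β s| * (‖Γ.endVal s u‖ * ‖Γ.endVal s v‖)
          ≤ |β s| * ((‖Γ.endVal s‖ * ‖u‖) * (‖Γ.endVal s‖ * ‖v‖)) := by
            gcongr <;> exact ContinuousLinearMap.le_opNorm _ _
        _ = _ := by ring
  isCompact := Γ.isCompactOperator_brokenToL2.comp_clm _
  injective := Γ.brokenToL2_injective.comp Subtype.val_injective
  coercive := by
    choose C hC0 hC using fun e => EdgeSobolev.exists_energy_coercive (Γ.length_pos e).le (hq e)
      (Γ.length_pos e) (β (e, false)) (β (e, true))
    refine ⟨∑ e, C e, 1 / 2, by norm_num, fun u => ?_⟩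
    have hn : ‖u‖ ^ 2 = ∑ e, ‖(u : Γ.Broken) e‖ ^ 2 := PiLp.norm_sq_eq_of_L2 _ _
    rw [form_apply, brokenForm_apply, formToL2_apply, inner_brokenToL2, hn, sum_edge_ends,
      Finset.mul_sum, ← Finset.sum_add_distrib]
    have hI : ∀ e, 0 ≤ ∫ x in (0 : ℝ)..Γ.length e,
        ((u : Γ.Broken) e).val x * ((u : Γ.Broken) e).val x := fun e =>
      intervalIntegral.integral_nonneg (Γ.length_pos e).le fun x _ => mul_self_nonneg _
    rw [Finset.mul_sum, ← Finset.sum_add_distrib]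
    refine Finset.sum_le_sum fun e _ => ?_
    have h1 := hC e ((u : Γ.Broken) e)
    have h2 : C e * ∫ x in (0 : ℝ)..Γ.length e,
          ((u : Γ.Broken) e).val x * ((u : Γ.Broken) e).val x ≤
        (∑ e, C e) * ∫ x in (0 : ℝ)..Γ.length e,
          ((u : Γ.Broken) e).val x * ((u : Γ.Broken) e).val x := by
      have := hI e
      gcongr
      exact Finset.single_le_sum (f := C) (fun e _ => hC0 e) (Finset.mem_univ e)
    have h3 : ∀ b, Γ.endVal (e, b) (u : Γ.Broken) =
        ((u : Γ.Broken) e).val (Γ.endPos (e, b)) := fun b => rfl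
    rw [h3, h3]
    simp only [endPos, ← sq]
    simp only [← sq] at h1 h2
    linarith

end FormDomain

end MetricGraph

/-! ### Regularity of weak solutions on an interval. -/

section Regularity

theorem AbsolutelyContinuousOnInterval.congr {f g : ℝ → ℝ} {a b : ℝ}
    (hf : AbsolutelyContinuousOnInterval f a b) (h : EqOn f g (uIcc a b)) :
    AbsolutelyContinuousOnInterval g a b := by
  rw [absolutelyContinuousOnInterval_iff] at hf ⊢
  intro ε hε
  obtain ⟨δ, hδ, H⟩ := hf ε hε
  refine ⟨δ, hδ, fun I hI hlt => ?_⟩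
  convert H I hI hlt using 1
  refine Finset.sum_congr rfl fun i hi => ?_
  have hm := hI.1 i hi
  rw [h hm.1, h hm.2]

namespace EdgeSobolev

variable {ℓ : ℝ}

theorem memLp_of_continuousOn {g : ℝ → ℝ} (hg : ContinuousOn g (Icc 0 ℓ)) :
    MemLp g 2 ((volume : Measure ℝ).restrict (Ioc 0 ℓ)) := by
  obtain ⟨C, hC⟩ := isCompact_Icc.exists_bound_of_continuousOn hg
  refine MemLp.of_bound ((hg.mono Ioc_subset_Icc_self).aestronglyMeasurable measurableSet_Ioc) C ?_
  rw [ae_restrict_iff' measurableSet_Ioc]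
  exact Eventually.of_forall fun x hx => hC x (Ioc_subset_Icc_self hx)

/-- Integration by parts against a Sobolev function. -/
theorem integral_mul_snd_add (hℓ : 0 ≤ ℓ) {G r : ℝ → ℝ}
    (hG : AbsolutelyContinuousOnInterval G 0 ℓ)
    (hd : ∀ᵐ x, x ∈ Ioo 0 ℓ → HasDerivAt G (r x) x) (w : EdgeSobolev ℓ) :
    (∫ x in Ioc 0 ℓ, G x * w.snd x) + ∫ x in (0 : ℝ)..ℓ, r x * w.val x =
      G ℓ * w.val ℓ - G 0 * w.val 0 := by
  have hw := w.absolutelyContinuous_val hℓ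
  have h1 := hG.integral_mul_deriv_eq_deriv_mul hw
  have h2 : ∫ x in (0 : ℝ)..ℓ, G x * deriv w.val x = ∫ x in Ioc 0 ℓ, G x * w.snd x := by
    rw [← intervalIntegral.integral_of_le hℓ]
    refine intervalIntegral.integral_congr_ae ?_
    filter_upwards [w.ae_hasDerivAt_val] with x hx hxI
    rw [uIoc_of_le hℓ] at hxI
    rw [(hx (Ioc_subset_Icc_self hxI)).deriv]
  have h3 : ∫ x in (0 : ℝ)..ℓ, deriv G x * w.val x = ∫ x in (0 : ℝ)..ℓ, r x * w.val x := by
    refine intervalIntegral.integral_congr_ae ?_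
    filter_upwards [hd, Measure.ae_ne volume ℓ] with x hx hxℓ hxI
    rw [uIoc_of_le hℓ] at hxI
    rw [(hx ⟨hxI.1, lt_of_le_of_ne hxI.2 hxℓ⟩).deriv]
  rw [← h2, h1, h3]
  ring

/-- A weak solution of `u'' = r` has an absolutely continuous derivative. -/
theorem exists_absolutelyContinuous_deriv (hℓ : 0 < ℓ) {r : ℝ → ℝ}
    (hr : IntervalIntegrable r volume 0 ℓ) (u : EdgeSobolev ℓ)
    (h : ∀ w : EdgeSobolev ℓ, w.val 0 = 0 → w.val ℓ = 0 →
      (∫ x in Ioc 0 ℓ, u.snd x * w.snd x) + ∫ x in (0 : ℝ)..ℓ, r x * w.val x = 0) :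
    ∃ G : ℝ → ℝ, AbsolutelyContinuousOnInterval G 0 ℓ ∧
      u.snd =ᵐ[(volume : Measure ℝ).restrict (Ioc 0 ℓ)] G ∧
      ∀ᵐ x, x ∈ Ioo 0 ℓ → HasDerivAt G (r x) x := by
  set G₀ : ℝ → ℝ := fun x => ∫ t in (0 : ℝ)..x, r t
  have hG₀ac : AbsolutelyContinuousOnInterval G₀ 0 ℓ :=
    hr.absolutelyContinuousOnInterval_intervalIntegral left_mem_uIcc
  -- `κ` is the mean of `u' - G₀`, so the antiderivative `w` of `u' - G` vanishes at both ends and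
  -- is an admissible test function. Testing with it gives `∫ (u' - G)² = 0`, the du Bois-Reymond
  -- argument.
  set κ : ℝ := ℓ⁻¹ * ∫ x in (0 : ℝ)..ℓ, (u.snd x - G₀ x) with hκ
  set G : ℝ → ℝ := fun x => κ + G₀ x with hG
  have hGac : AbsolutelyContinuousOnInterval G 0 ℓ :=
    (LipschitzWith.const κ).lipschitzOnWith.absolutelyContinuousOnInterval.add hG₀ac
  have hGd : ∀ᵐ x, x ∈ Ioo 0 ℓ → HasDerivAt G (r x) x := by
    filter_upwards [hr.ae_hasDerivAt_integral] with x hx hxI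
    refine (hx ?_ 0 left_mem_uIcc).const_add κ
    rw [uIcc_of_le hℓ.le]
    exact Ioo_subset_Icc_self hxI
  have hGc : ContinuousOn G (Icc 0 ℓ) := by
    have := hGac.continuousOn
    rwa [uIcc_of_le hℓ.le] at this
  have hGL := memLp_of_continuousOn hGc
  have hdL : MemLp (fun x => u.snd x - G x) 2 ((volume : Measure ℝ).restrict (Ioc 0 ℓ)) :=
    (Lp.memLp u.snd).sub hGL
  refine ⟨G, hGac, ?_, hGd⟩
  set w : EdgeSobolev ℓ := ofDeriv 0 _ hdL with hw
  have hw0 : w.val 0 = 0 := by rw [val_zero_right]; rfl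
  have hwℓ : w.val ℓ = 0 := by
    have hi1 := u.intervalIntegrable_snd (left_mem_Icc.2 hℓ.le) (right_mem_Icc.2 hℓ.le)
    have hi2 : IntervalIntegrable G₀ volume 0 ℓ := hG₀ac.continuousOn.intervalIntegrable
    rw [hw, ofDeriv_val hdL (right_mem_Icc.2 hℓ.le), zero_add]
    have h1 : ∀ x, u.snd x - G x = (u.snd x - G₀ x) - κ := fun x => by simp only [hG]; ring
    simp only [h1]
    rw [intervalIntegral.integral_sub (hi1.sub hi2) intervalIntegrable_const,
      intervalIntegral.integral_const, hκ]
    simp only [sub_zero, smul_eq_mul]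
    field_simp
    ring
  have h1 := h w hw0 hwℓ
  have h2 := integral_mul_snd_add hℓ.le hGac hGd w
  rw [hw0, hwℓ, mul_zero, mul_zero, sub_zero] at h2
  have hsnd : w.snd =ᵐ[(volume : Measure ℝ).restrict (Ioc 0 ℓ)] fun x => u.snd x - G x :=
    ofDeriv_snd hdL
  have hI1 : Integrable (fun x => u.snd x * w.snd x) (volume.restrict (Ioc 0 ℓ)) :=
    (Lp.memLp u.snd).integrable_mul (Lp.memLp w.snd)
  have hI2 : Integrable (fun x => G x * w.snd x) (volume.restrict (Ioc 0 ℓ)) :=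
    hGL.integrable_mul (Lp.memLp w.snd)
  have h3 : ∫ x in Ioc 0 ℓ, (u.snd x - G x) ^ 2 = 0 := by
    have h4 : ∫ x in Ioc 0 ℓ, (u.snd x - G x) ^ 2 =
        ∫ x in Ioc 0 ℓ, (u.snd x * w.snd x - G x * w.snd x) := by
      refine integral_congr_ae (hsnd.mono fun x hx => ?_)
      simp only [hx]
      ring
    rw [h4, integral_sub hI1 hI2]
    linarith
  have h5 := (integral_eq_zero_iff_of_nonneg (fun x => sq_nonneg _) hdL.integrable_sq).1 h3
  filter_upwards [h5] with x hx
  have : (u.snd x - G x) ^ 2 = 0 := hx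
  exact sub_eq_zero.1 (pow_eq_zero_iff two_ne_zero |>.1 this)

/-- Extending `G` by constants beyond `[0, ℓ]` makes it continuous on `ℝ`, so the fundamental
theorem of calculus also covers the endpoints. -/
theorem hasDerivWithinAt_val (hℓ : 0 ≤ ℓ) (u : EdgeSobolev ℓ) {G : ℝ → ℝ}
    (hG : ContinuousOn G (Icc 0 ℓ))
    (hu : u.snd =ᵐ[(volume : Measure ℝ).restrict (Ioc 0 ℓ)] G) {x : ℝ} (hx : x ∈ Icc 0 ℓ) :
    HasDerivWithinAt u.val (G x) (Icc 0 ℓ) x := by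
  have hc : Continuous (IccExtend hℓ ((Icc 0 ℓ).domRestrict G)) :=
    (continuousOn_iff_continuous_domRestrict.1 hG).Icc_extend'
  have heq : ∀ y ∈ Icc 0 ℓ, IccExtend hℓ ((Icc 0 ℓ).domRestrict G) y = G y := fun y hy =>
    IccExtend_of_mem hℓ _ hy
  have h1 := ((hc.integral_hasStrictDerivAt 0 x).hasDerivAt.const_add u.fst).hasDerivWithinAt
    (s := Icc 0 ℓ)
  rw [heq x hx] at h1
  have h2 : ∀ y ∈ Icc 0 ℓ, u.val y =
      u.fst + ∫ t in (0 : ℝ)..y, IccExtend hℓ ((Icc 0 ℓ).domRestrict G) t := by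
    intro y hy
    rw [val]
    congr 1
    refine intervalIntegral_congr_ae (hu.trans ?_) (left_mem_Icc.2 hℓ) hy
    rw [Filter.EventuallyEq, ae_restrict_iff' measurableSet_Ioc]
    exact Eventually.of_forall fun t ht => (heq t (Ioc_subset_Icc_self ht)).symm
  exact h1.congr h2 (h2 x hx)

end EdgeSobolev

end Regularity

/-! ### Form domain elements as functions on the graph, and Green's formula. -/

namespace MetricGraph

variable {V E : Type*} (Γ : MetricGraph V E)

section ToFun

variable {α : V → WithTop ℝ}

/-- The function on the metric graph given by an element of the form domain. -/
noncomputable def toFun : Γ.formDomain α →ₗ[ℝ] (Γ.Point → ℝ) where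
  toFun u := Quot.lift (fun x : Γ.EdgeUnion => ((u : Γ.Broken) x.1).val x.2) (by
    rintro _ _ ⟨s, t, hst, rfl, rfl⟩
    have h : ∀ s, ((u : Γ.Broken) (Γ.endOf s).1).val (Γ.endOf s).2 = Γ.endVal s u := by
      rintro ⟨e, b⟩
      cases b <;> rfl
    rw [h, h]
    exact u.2.1 s t hst)
  map_add' u v := by
    ext x
    induction x using Quot.ind with
    | mk x => exact EdgeSobolev.val_add _ _ x.2.2
  map_smul' c u := by
    ext x
    induction x using Quot.ind with
    | mk x => exact EdgeSobolev.val_smul _ _ x.2.2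

theorem toFun_edge (u : Γ.formDomain α) {e : E} {x : ℝ} (hx : x ∈ Icc 0 (Γ.length e)) :
    Γ.toFun u (Γ.edge e x) = ((u : Γ.Broken) e).val x := by
  rw [edge_of_mem Γ hx]
  rfl

theorem toFun_vertexOf (u : Γ.formDomain α) (s : E × Bool) :
    Γ.toFun u (Γ.vertex (Γ.vertexOf s)) = Γ.endVal s u := by
  rw [← edge_endPos, toFun_edge Γ u (Γ.endPos_mem s)]
  rfl

theorem toFun_injective : Function.Injective (Γ.toFun (α := α)) := by
  intro u v h
  refine Subtype.ext ?_
  ext1 e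
  refine EdgeSobolev.ext_of_val (Γ.length_pos e) fun x hx => ?_
  rw [← toFun_edge Γ u hx, ← toFun_edge Γ v hx, h]

theorem continuous_toFun (u : Γ.formDomain α) : Continuous (Γ.toFun u) := by
  refine continuous_quot_lift _ ?_
  rw [continuous_sigma_iff]
  intro e
  exact continuousOn_iff_continuous_domRestrict.1 ((u : Γ.Broken) e).continuousOn_val

end ToFun

section Green

variable {q : E → ℝ → ℝ} (hq : ∀ e, IntervalIntegrable (q e) volume 0 (Γ.length e))
  (β : E × Bool → ℝ)

theorem energy_sub (l : ℝ) (e : E) (u w : EdgeSobolev (Γ.length e)) :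
    EdgeSobolev.energy (Γ.length_pos e).le (hq e) u w
      - l * ∫ x in (0 : ℝ)..Γ.length e, u.val x * w.val x =
    (∫ x in Ioc 0 (Γ.length e), u.snd x * w.snd x) +
      ∫ x in (0 : ℝ)..Γ.length e, (q e x * u.val x - l * u.val x) * w.val x := by
  have hle := (Γ.length_pos e).le
  rw [EdgeSobolev.energy_apply, ← intervalIntegral.integral_const_mul, add_sub_assoc,
    ← intervalIntegral.integral_sub (EdgeSobolev.intervalIntegrable_mul_val (hq e) hle u w)
      ((EdgeSobolev.continuousOn_val_mul_val u w hle).intervalIntegrable.const_mul l)]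
  congr 2
  ext x
  ring

variable [Fintype E]

theorem form_sub (l : ℝ) (u w : Γ.Broken) :
    Γ.brokenForm hq β u w - l * inner ℝ (Γ.brokenToL2 u) (Γ.brokenToL2 w) =
    ∑ e, ((∫ x in Ioc 0 (Γ.length e), (u e).snd x * (w e).snd x) +
      ∫ x in (0 : ℝ)..Γ.length e, (q e x * (u e).val x - l * (u e).val x) * (w e).val x) +
      ∑ s, β s * (Γ.endVal s u * Γ.endVal s w) := by
  rw [brokenForm_apply, inner_brokenToL2, Finset.mul_sum, add_sub_right_comm,
    ← Finset.sum_sub_distrib]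
  simp only [energy_sub Γ hq]

/-- The value of `G` at an edge end, with the sign that makes it point into the edge. -/
def inwardValue (G : E → ℝ → ℝ) : E × Bool → ℝ
  | (e, false) => G e 0
  | (e, true) => -G e (Γ.length e)

/-- Green's formula on the metric graph. -/
theorem form_sub_eq_sum (l : ℝ) (u w : Γ.Broken) {G : E → ℝ → ℝ}
    (hG : ∀ e, AbsolutelyContinuousOnInterval (G e) 0 (Γ.length e))
    (hu : ∀ e, (u e).snd =ᵐ[(volume : Measure ℝ).restrict (Ioc 0 (Γ.length e))] G e)
    (hd : ∀ e, ∀ᵐ x, x ∈ Ioo 0 (Γ.length e) →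
      HasDerivAt (G e) (q e x * (u e).val x - l * (u e).val x) x) :
    Γ.brokenForm hq β u w - l * inner ℝ (Γ.brokenToL2 u) (Γ.brokenToL2 w) =
      ∑ s, (β s * Γ.endVal s u - Γ.inwardValue G s) * Γ.endVal s w := by
  rw [form_sub]
  have h1 : ∀ e, (∫ x in Ioc 0 (Γ.length e), (u e).snd x * (w e).snd x) +
      ∫ x in (0 : ℝ)..Γ.length e, (q e x * (u e).val x - l * (u e).val x) * (w e).val x =
      -(Γ.inwardValue G (e, false) * Γ.endVal (e, false) w +
        Γ.inwardValue G (e, true) * Γ.endVal (e, true) w) := by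
    intro e
    have h2 : ∫ x in Ioc 0 (Γ.length e), (u e).snd x * (w e).snd x =
        ∫ x in Ioc 0 (Γ.length e), G e x * (w e).snd x := by
      refine integral_congr_ae ((hu e).mono fun x hx => ?_)
      simp only [hx]
    rw [h2, EdgeSobolev.integral_mul_snd_add (Γ.length_pos e).le (hG e) (hd e)]
    simp only [inwardValue, endVal_apply, endPos]
    ring
  simp only [h1, Finset.sum_neg_distrib]
  rw [← sum_edge_ends (fun s => Γ.inwardValue G s * Γ.endVal s w), neg_add_eq_sub,
    ← Finset.sum_sub_distrib]
  exact Finset.sum_congr rfl fun s _ => by ring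

end Green

end MetricGraph

/-! ### Weak eigenvectors are exactly the solutions of the eigenvalue problem. -/

namespace MetricGraph

variable {V E : Type*} (Γ : MetricGraph V E)

section Eigenspace

open Classical in
/-- The coupling strengths, each attached to one edge end of the vertex. -/
noncomputable def endWeight (α : V → WithTop ℝ) (s : E × Bool) : ℝ :=
  if s = Function.surjInv Γ.vertexOf_surjective (Γ.vertexOf s) then
    (α (Γ.vertexOf s)).untopD 0 else 0

/-- An element of the form domain with given vertex values. -/
theorem exists_formDomain_endVal_eq {α : V → WithTop ℝ} {W : V → ℝ}
    (hW : ∀ v, α v = ⊤ → W v = 0) :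
    ∃ w : Γ.formDomain α, ∀ s, Γ.endVal s w = W (Γ.vertexOf s) := by
  set a : E → ℝ := fun e => W (Γ.vertexOf (e, false))
  set b : E → ℝ := fun e => W (Γ.vertexOf (e, true))
  set w : Γ.Broken := WithLp.toLp 2 fun e => EdgeSobolev.ofDeriv (a e)
    (fun _ => (b e - a e) / Γ.length e)
    (EdgeSobolev.memLp_of_continuousOn continuousOn_const) with hw
  have key : ∀ s, Γ.endVal s w = W (Γ.vertexOf s) := by
    intro s
    have hs := Γ.endPos_mem s
    rw [endVal_apply, hw]
    obtain ⟨e, c⟩ := s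
    refine (EdgeSobolev.ofDeriv_val _ hs).trans ?_
    have := (Γ.length_pos e).ne'
    cases c
    · simp [endPos, a]
    · simp only [endPos, intervalIntegral.integral_const, sub_zero, smul_eq_mul]
      field_simp
      simp [b]
  refine ⟨⟨w, fun s t hst => ?_, fun s hs => ?_⟩, key⟩
  · rw [key, key, hst]
  · rw [key, hW _ hs]

/-- Extension by zero from one edge satisfies every vertex condition of the form domain, whatever
`α` is. Both the interior test functions and the sine bumps enter in this way. -/
theorem endVal_single [DecidableEq E] {e : E} {w : EdgeSobolev (Γ.length e)}
    (hw0 : w.val 0 = 0) (hwℓ : w.val (Γ.length e) = 0) (s : E × Bool) :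
    Γ.endVal s (PiLp.single 2 e w) = 0 := by
  obtain ⟨e', b⟩ := s
  by_cases he : e' = e
  · subst he
    rw [endVal_apply]
    cases b
    · simpa [endPos] using hw0
    · simpa [endPos] using hwℓ
  · rw [endVal, ContinuousLinearMap.comp_apply]
    have : PiLp.proj 2 (𝕜 := ℝ) (fun e => EdgeSobolev (Γ.length e)) e'
      (PiLp.single 2 e w) = 0 := by simp [he]
    rw [this, map_zero]

variable [Fintype E]

-- Only the end selected by `surjInv` carries the strength of its vertex. The default `0` at
-- Dirichlet vertices is harmless, since the form domain vanishes there.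
open Classical in
theorem sum_endWeight (α : V → WithTop ℝ) (v : V) :
    ∑ s with Γ.vertexOf s = v, Γ.endWeight α s = (α v).untopD 0 := by
  have hv := Function.surjInv_eq Γ.vertexOf_surjective v
  rw [Finset.sum_eq_single (Function.surjInv Γ.vertexOf_surjective v)]
  · rw [endWeight, hv, if_pos rfl]
  · intro s hs hne
    rw [Finset.mem_filter] at hs
    rw [endWeight, hs.2, if_neg hne]
  · intro h
    simp [hv] at h

variable {q : Γ.Point → ℝ} {α : V → WithTop ℝ}
  (hq : ∀ e, IntervalIntegrable (fun x => q (Γ.edge e x)) volume 0 (Γ.length e))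

-- Groups the boundary terms of Green's formula by vertices. When `G` is the inward derivative, the
-- factor of `W v` is the defect in the `δ`-condition at a vertex of finite strength.
open Classical in
theorem sum_endWeight_mul (u : Γ.formDomain α) (f : Γ.Point → ℝ) (hf : f = Γ.toFun u)
    (G : E × Bool → ℝ) (W : V → ℝ) :
    ∑ s, (Γ.endWeight α s * Γ.endVal s u - G s) * W (Γ.vertexOf s) =
      ∑ v ∈ Finset.univ.image Γ.vertexOf,
        ((α v).untopD 0 * f (Γ.vertex v) - ∑ s with Γ.vertexOf s = v, G s) * W v := by
  rw [← Finset.sum_fiberwise_of_maps_to (s := (Finset.univ : Finset (E × Bool)))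
    (t := Finset.univ.image Γ.vertexOf) (g := Γ.vertexOf)
    fun s _ => Finset.mem_image_of_mem _ (Finset.mem_univ s)]
  refine Finset.sum_congr rfl fun v _ => ?_
  rw [← sum_endWeight Γ, Finset.sum_mul, ← Finset.sum_sub_distrib, Finset.sum_mul]
  refine Finset.sum_congr rfl fun s hs => ?_
  rw [← (Finset.mem_filter.1 hs).2, hf, toFun_vertexOf]

/-- Test functions supported on one edge and vanishing at its ends give the differential equation
and the regularity. Test functions with prescribed vertex values then give the flux condition. -/
theorem isSolution_toFun {l : ℝ} {u : Γ.formDomain α}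
    (hu : u ∈ weakEigenspace (Γ.form hq (Γ.endWeight α) α) (Γ.formToL2 α) l) :
    Γ.IsSolution q α l (Γ.toFun u) := by
  classical
  have hle := fun e => (Γ.length_pos e).le
  set F : E → ℝ → ℝ := fun e => ((u : Γ.Broken) e).val
  have hr : ∀ e, IntervalIntegrable (fun x => q (Γ.edge e x) * F e x - l * F e x)
      volume 0 (Γ.length e) := by
    intro e
    have hc : ContinuousOn (F e) (uIcc 0 (Γ.length e)) := by
      rw [uIcc_of_le (hle e)]
      exact EdgeSobolev.continuousOn_val _
    exact ((hq e).mul_continuousOn hc).sub (hc.intervalIntegrable.const_mul l)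
  have hweak : ∀ w : Γ.formDomain α, Γ.brokenForm hq (Γ.endWeight α) u w -
      l * inner ℝ (Γ.brokenToL2 u) (Γ.brokenToL2 w) = 0 := fun w => sub_eq_zero.2 (hu w)
  have hex : ∀ e, ∃ G : ℝ → ℝ, AbsolutelyContinuousOnInterval G 0 (Γ.length e) ∧
      ((u : Γ.Broken) e).snd =ᵐ[(volume : Measure ℝ).restrict (Ioc 0 (Γ.length e))] G ∧
      ∀ᵐ x, x ∈ Ioo 0 (Γ.length e) →
        HasDerivAt G (q (Γ.edge e x) * F e x - l * F e x) x := by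
    intro e
    refine EdgeSobolev.exists_absolutelyContinuous_deriv (Γ.length_pos e) (hr e) _
      fun w hw0 hwℓ => ?_
    have hend := Γ.endVal_single hw0 hwℓ
    have h1 := hweak ⟨PiLp.single 2 e w, fun s t _ => by rw [hend, hend], fun s _ => hend s⟩
    rw [form_sub] at h1
    simp only [hend, mul_zero, Finset.sum_const_zero, add_zero] at h1
    simp only [← energy_sub Γ hq] at h1
    rw [Finset.sum_eq_single e] at h1
    · rw [energy_sub Γ hq] at h1
      simpa using h1
    · intro e' _ he
      have : (PiLp.single 2 e w : Γ.Broken) e' = 0 := by simp [he]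
      rw [energy_sub Γ hq, ← energy_sub Γ hq, this, map_zero,
        ← EdgeSobolev.inner_toL2 (hle e'), map_zero, inner_zero_right, mul_zero, sub_zero]
    · simp
  choose G hGac hGu hGd using hex
  have hGc : ∀ e, ContinuousOn (G e) (Icc 0 (Γ.length e)) := fun e => by
    have := (hGac e).continuousOn
    rwa [uIcc_of_le (hle e)] at this
  have hder : ∀ e, ∀ x ∈ Icc 0 (Γ.length e),
      HasDerivWithinAt (fun x => Γ.toFun u (Γ.edge e x)) (G e x) (Icc 0 (Γ.length e)) x :=
    fun e x hx => (EdgeSobolev.hasDerivWithinAt_val (hle e) _ (hGc e) (hGu e) hx).congr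
      (fun y hy => Γ.toFun_edge u hy) (Γ.toFun_edge u hx)
  have hedge : ∀ e, ∀ x ∈ Icc 0 (Γ.length e), Γ.edgeDeriv (Γ.toFun u) e x = G e x :=
    fun e x hx => (hder e x hx).derivWithin (uniqueDiffOn_Icc (Γ.length_pos e) x hx)
  have hinward : ∀ s, Γ.inwardDeriv (Γ.toFun u) s = Γ.inwardValue G s := by
    rintro ⟨e, b⟩
    cases b
    · exact hedge e 0 (left_mem_Icc.2 (hle e))
    · simp only [inwardDeriv, inwardValue, hedge e _ (right_mem_Icc.2 (hle e))]
  refine ⟨Γ.continuous_toFun u, fun e x hx => (hder e x hx).differentiableWithinAt, fun e => ?_,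
    fun e => ?_, fun v => ?_⟩
  · refine (hGac e).congr fun x hx => ?_
    rw [uIcc_of_le (hle e)] at hx
    exact (hedge e x hx).symm
  · filter_upwards [hGd e] with x hx hxI
    have hev : Γ.edgeDeriv (Γ.toFun u) e =ᶠ[𝓝 x] G e := by
      filter_upwards [Icc_mem_nhds hxI.1 hxI.2] with y hy using hedge e y hy
    rw [hev.deriv_eq, (hx hxI).deriv, toFun_edge Γ u (Ioo_subset_Icc_self hxI)]
    ring
  · cases hα : α v with
    | top =>
      obtain ⟨s, rfl⟩ := Γ.vertexOf_surjective v
      simp only [DeltaCoupling]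
      rw [toFun_vertexOf]
      exact u.2.2 s hα
    | coe a =>
      -- A test function equal to `1` at `v` and `0` at the other vertices isolates the condition at
      -- `v`. It is admissible because `α v` is finite.
      obtain ⟨w, hw⟩ := Γ.exists_formDomain_endVal_eq (α := α)
        (W := fun x => if x = v then 1 else 0) (fun x hx => by
          rw [if_neg]
          rintro rfl
          rw [hα] at hx
          exact WithTop.coe_ne_top hx)
      have h1 := hweak w
      rw [Γ.form_sub_eq_sum hq _ l u w hGac hGu hGd] at h1
      simp only [hw] at h1
      rw [Γ.sum_endWeight_mul u _ rfl (Γ.inwardValue G) (fun x => if x = v then 1 else 0)] at h1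
      simp only [mul_ite, mul_one, mul_zero] at h1
      rw [Finset.sum_ite_eq', if_pos] at h1
      · simp only [DeltaCoupling, vertexFlux, hinward]
        rw [hα, WithTop.untopD_coe] at h1
        linarith
      · obtain ⟨s, rfl⟩ := Γ.vertexOf_surjective v
        exact Finset.mem_image_of_mem _ (Finset.mem_univ s)

/-- Green's formula leaves one term per vertex: the coupling condition kills it where the strength
is finite, and the test function vanishes where it is infinite. -/
theorem exists_toFun_eq_of_isSolution {l : ℝ} {f : Γ.Point → ℝ} (hf : Γ.IsSolution q α l f) :
    ∃ u ∈ weakEigenspace (V := Γ.formDomain α) (K := Γ.BrokenL2)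
      (Γ.form hq (Γ.endWeight α) α) (Γ.formToL2 α) l, Γ.toFun u = f := by
  classical
  have hle := fun e => (Γ.length_pos e).le
  have hGac := hf.absolutelyContinuous
  have hGc : ∀ e, ContinuousOn (Γ.edgeDeriv f e) (Icc 0 (Γ.length e)) := fun e => by
    have := (hGac e).continuousOn
    rwa [uIcc_of_le (hle e)] at this
  set u : Γ.Broken := WithLp.toLp 2 fun e => EdgeSobolev.ofDeriv (f (Γ.edge e 0)) (Γ.edgeDeriv f e)
    (EdgeSobolev.memLp_of_continuousOn (hGc e))
  have hval : ∀ e, ∀ x ∈ Icc 0 (Γ.length e), (u e).val x = f (Γ.edge e x) := by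
    intro e x hx
    refine (EdgeSobolev.ofDeriv_val _ hx).trans ?_
    have hsub : Icc 0 x ⊆ Icc 0 (Γ.length e) := Icc_subset_Icc_right hx.2
    rw [intervalIntegral.integral_eq_sub_of_hasDerivAt_of_le (f := fun t => f (Γ.edge e t))
      (f' := Γ.edgeDeriv f e) hx.1
      ((hf.differentiableOn e).continuousOn.mono hsub)
      (fun y hy => ((hf.differentiableOn e y
        (hsub (Ioo_subset_Icc_self hy))).hasDerivWithinAt.hasDerivAt
          (Icc_mem_nhds hy.1 (hy.2.trans_le hx.2))))
      (((hGc e).mono hsub).intervalIntegrable_of_Icc hx.1)]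
    ring
  have hend : ∀ s, Γ.endVal s u = f (Γ.vertex (Γ.vertexOf s)) := fun s => by
    rw [endVal_apply, hval _ _ (Γ.endPos_mem s), edge_endPos]
  have hmem : u ∈ Γ.formDomain α := by
    refine ⟨fun s t hst => by rw [hend, hend, hst], fun s hs => ?_⟩
    have := hf.coupling (Γ.vertexOf s)
    rw [hs] at this
    rw [hend]
    exact this
  have hfun : Γ.toFun ⟨u, hmem⟩ = f := by
    ext x
    induction x using Quot.ind with
    | mk x =>
      obtain ⟨e, x, hx⟩ := x
      have h1 := Γ.toFun_edge ⟨u, hmem⟩ hx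
      rw [hval e x hx, edge_of_mem Γ hx] at h1
      exact h1
  refine ⟨⟨u, hmem⟩, fun w => ?_, hfun⟩
  rw [← sub_eq_zero]
  refine (Γ.form_sub_eq_sum hq _ l u w hGac (fun e => EdgeSobolev.ofDeriv_snd _)
    (fun e => ?_)).trans ?_
  · filter_upwards [hf.equation e, (hGac e).ae_differentiableAt] with x hx hd hxI
    have hxI' := Ioo_subset_Icc_self hxI
    rw [hval e x hxI']
    have h1 := (hd (by rwa [uIcc_of_le (hle e)])).hasDerivAt
    refine h1.congr_deriv ?_
    linarith [hx hxI]
  · simp only [← toFun_vertexOf Γ w]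
    rw [Γ.sum_endWeight_mul ⟨u, hmem⟩ f hfun.symm _ (fun v => Γ.toFun w (Γ.vertex v))]
    refine Finset.sum_eq_zero fun v _ => ?_
    have hc := hf.coupling v
    cases hα : α v with
    | top =>
      obtain ⟨s, rfl⟩ := Γ.vertexOf_surjective v
      rw [toFun_vertexOf, w.2.2 s hα, mul_zero]
    | coe a =>
      rw [hα] at hc
      simp only [DeltaCoupling, vertexFlux] at hc
      have hinward : ∀ s, Γ.inwardValue (Γ.edgeDeriv f) s = Γ.inwardDeriv f s := by
        rintro ⟨e, b⟩
        cases b <;> rfl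
      simp only [hinward]
      rw [hc, WithTop.untopD_coe, sub_self, zero_mul]

theorem map_toFun_weakEigenspace (l : ℝ) :
    (weakEigenspace (V := Γ.formDomain α) (K := Γ.BrokenL2)
      (Γ.form hq (Γ.endWeight α) α) (Γ.formToL2 α) l).map Γ.toFun =
      Γ.eigenspace q α l := by
  ext f
  constructor
  · rintro ⟨u, hu, rfl⟩
    exact Γ.isSolution_toFun hq hu
  · intro hf
    obtain ⟨u, hu, rfl⟩ := Γ.exists_toFun_eq_of_isSolution hq hf
    exact ⟨u, hu, rfl⟩

/-- The weak eigenspace is isomorphic to the eigenspace. -/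
noncomputable def weakEigenspaceEquiv (l : ℝ) :
    weakEigenspace (V := Γ.formDomain α) (K := Γ.BrokenL2)
      (Γ.form hq (Γ.endWeight α) α) (Γ.formToL2 α) l ≃ₗ[ℝ] Γ.eigenspace q α l :=
  (Submodule.equivMapOfInjective Γ.toFun Γ.toFun_injective _).trans
    (LinearEquiv.ofEq _ _ (Γ.map_toFun_weakEigenspace hq l))

end Eigenspace

end MetricGraph

/-! ### Bounding a weighted mean by an `Lᵖ` norm. -/

section Jensen

/-- Jensen's inequality for a probability density `w ≤ c`, in the form of a bound by `Lᵖ` norms. -/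
theorem integral_abs_mul_le_of_density_le {X : Type*} [MeasurableSpace X] {μ : Measure X}
    {p : ENNReal} (hp : 1 ≤ p) {g w : X → ℝ} {c : ℝ} (hc : 0 < c) (hg : MemLp g p μ)
    (hw : Measurable w) (hw0 : ∀ x, 0 ≤ w x) (hwc : ∀ x, w x ≤ c) (hwi : Integrable w μ)
    (hw1 : ∫ x, w x ∂μ = 1) :
    ∫ x, |g x| * w x ∂μ ≤ c ^ (1 / p).toReal * (eLpNorm g p μ).toReal := by
  set ρ : X → ENNReal := fun x => ENNReal.ofReal (w x) with hρ
  have hρm : Measurable ρ := hw.ennreal_ofReal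
  set P := μ.withDensity ρ with hP
  have hPac : P ≪ μ := withDensity_absolutelyContinuous μ ρ
  have hPprob : IsProbabilityMeasure P := ⟨by
    rw [hP, withDensity_apply _ MeasurableSet.univ, Measure.restrict_univ,
      ← ofReal_integral_eq_lintegral_ofReal hwi (Eventually.of_forall hw0), hw1,
      ENNReal.ofReal_one]⟩
  have hgP : AEStronglyMeasurable g P := hg.1.mono_ac hPac
  have h1 : ∫ x, |g x| * w x ∂μ = (eLpNorm g 1 P).toReal := by
    rw [eLpNorm_one_eq_lintegral_enorm, ← integral_norm_eq_lintegral_enorm hgP, hP,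
      integral_withDensity_eq_integral_toReal_smul hρm
        (Eventually.of_forall fun x => ENNReal.ofReal_lt_top)]
    refine integral_congr_ae (Eventually.of_forall fun x => ?_)
    simp only [hρ, ENNReal.toReal_ofReal (hw0 x), smul_eq_mul, Real.norm_eq_abs]
    ring
  -- For the probability measure `P` the `L¹` norm is at most the `Lᵖ` norm, and passing from `P` to
  -- `c μ` costs `c ^ (1/p)`. The exponent is `0` for `p = ∞`.
  have hPle : P ≤ ENNReal.ofReal c • μ := by
    rw [← withDensity_const]
    exact withDensity_mono (Eventually.of_forall fun x => ENNReal.ofReal_le_ofReal (hwc x))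
  have h2 : eLpNorm g 1 P ≤ ENNReal.ofReal c ^ (1 / p).toReal * eLpNorm g p μ := by
    refine (eLpNorm_le_eLpNorm_of_exponent_le hp hgP).trans ?_
    refine (eLpNorm_mono_measure g hPle).trans_eq ?_
    rw [eLpNorm_smul_measure_of_ne_zero (by simpa using hc), smul_eq_mul]
  have hfin : ENNReal.ofReal c ^ (1 / p).toReal * eLpNorm g p μ ≠ ⊤ :=
    ENNReal.mul_ne_top (ENNReal.rpow_ne_top_of_nonneg ENNReal.toReal_nonneg ENNReal.ofReal_ne_top)
      hg.2.ne
  rw [h1]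
  refine (ENNReal.toReal_mono hfin h2).trans_eq ?_
  rw [ENNReal.toReal_mul, ← ENNReal.toReal_rpow, ENNReal.toReal_ofReal hc.le]

end Jensen

/-! ### Sine bumps: norms, energies and orthogonality. -/

section Bump

namespace EdgeSobolev

variable {ℓ : ℝ}

/-- The derivative of the sine bump on the interval `[s, s + a]`. -/
noncomputable def bumpDeriv (a s : ℝ) : ℝ → ℝ :=
  indicator (Ioc s (s + a)) fun t => Real.pi / a * Real.cos (Real.pi / a * t - Real.pi / a * s)

/-- The sine bump on the interval `[s, s + a]`. -/
noncomputable def bumpVal (a s : ℝ) : ℝ → ℝ :=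
  indicator (Ioc s (s + a)) fun t => Real.sin (Real.pi / a * t - Real.pi / a * s)

theorem memLp_bumpDeriv (a s : ℝ) :
    MemLp (bumpDeriv a s) 2 ((volume : Measure ℝ).restrict (Ioc 0 ℓ)) :=
  (memLp_of_continuousOn (by fun_prop)).indicator measurableSet_Ioc

/-- The sine bump on `[s, s + a]` as an element of the Sobolev space. -/
noncomputable def bump (ℓ a s : ℝ) : EdgeSobolev ℓ :=
  ofDeriv 0 (bumpDeriv a s) (memLp_bumpDeriv a s)

theorem bump_snd (a s : ℝ) :
    (bump ℓ a s).snd =ᵐ[(volume : Measure ℝ).restrict (Ioc 0 ℓ)] bumpDeriv a s :=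
  ofDeriv_snd _

variable {a s : ℝ}

theorem integral_bumpDeriv (ha : 0 < a) (hs : 0 ≤ s) {x : ℝ} (hx : 0 ≤ x) :
    ∫ t in (0 : ℝ)..x, bumpDeriv a s t = bumpVal a s x := by
  have hder : ∀ t, HasDerivAt (fun t => Real.sin (Real.pi / a * t - Real.pi / a * s))
      (Real.pi / a * Real.cos (Real.pi / a * t - Real.pi / a * s)) t := fun t => by
    have := (((hasDerivAt_id t).const_mul (Real.pi / a)).sub_const (Real.pi / a * s)).sin
    simpa [mul_comm] using this
  have hint : ∀ y, ∫ t in s..y, Real.pi / a * Real.cos (Real.pi / a * t - Real.pi / a * s) =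
      Real.sin (Real.pi / a * y - Real.pi / a * s) := fun y => by
    rw [intervalIntegral.integral_eq_sub_of_hasDerivAt (fun t _ => hder t)
      (Continuous.intervalIntegrable (by fun_prop) _ _)]
    simp
  rw [intervalIntegral.integral_of_le hx, bumpDeriv, setIntegral_indicator measurableSet_Ioc,
    Ioc_inter_Ioc, max_eq_right hs, bumpVal]
  rcases le_or_gt x s with hxs | hxs
  · rw [Ioc_eq_empty (not_lt.2 ((min_le_left _ _).trans hxs)), Measure.restrict_empty,
      integral_zero_measure, indicator_of_notMem (fun h => absurd h.1 (not_lt.2 hxs))]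
  · rcases le_or_gt x (s + a) with hxa | hxa
    · rw [min_eq_left hxa, ← intervalIntegral.integral_of_le hxs.le, hint,
        indicator_of_mem (show x ∈ Ioc s (s + a) from ⟨hxs, hxa⟩)]
    · rw [min_eq_right hxa.le, ← intervalIntegral.integral_of_le (by linarith), hint,
        indicator_of_notMem (fun h => absurd h.2 (not_le.2 hxa))]
      rw [show Real.pi / a * (s + a) - Real.pi / a * s = Real.pi by field_simp; ring, Real.sin_pi]

theorem bump_val (ha : 0 < a) (hs : 0 ≤ s) {x : ℝ} (hx : x ∈ Icc 0 ℓ) :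
    (bump ℓ a s).val x = bumpVal a s x := by
  rw [bump, ofDeriv_val _ hx, zero_add, integral_bumpDeriv ha hs hx.1]

theorem bumpVal_eq_zero_of_le {x : ℝ} (hx : x ≤ s) : bumpVal a s x = 0 :=
  indicator_of_notMem (fun h => absurd h.1 (not_lt.2 hx)) _

theorem bumpVal_eq_zero_of_ge (ha : 0 < a) {x : ℝ} (hx : s + a ≤ x) : bumpVal a s x = 0 := by
  rcases hx.eq_or_lt with rfl | hx
  · rw [bumpVal, indicator_of_mem (show s + a ∈ Ioc s (s + a) from ⟨by linarith, le_rfl⟩),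
      show Real.pi / a * (s + a) - Real.pi / a * s = Real.pi by field_simp; ring, Real.sin_pi]
  · exact indicator_of_notMem (fun h => absurd h.2 (not_le.2 hx)) _

theorem setIntegral_indicator_interval (hs : 0 ≤ s) (ha : 0 < a) (hsℓ : s + a ≤ ℓ) (f : ℝ → ℝ) :
    ∫ x in Ioc 0 ℓ, indicator (Ioc s (s + a)) f x = ∫ x in s..(s + a), f x := by
  rw [setIntegral_indicator measurableSet_Ioc, inter_eq_self_of_subset_right
    (Ioc_subset_Ioc hs hsℓ), intervalIntegral.integral_of_le (by linarith)]

theorem integral_bumpDeriv_sq (ha : 0 < a) (hs : 0 ≤ s) (hsℓ : s + a ≤ ℓ) :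
    ∫ x in Ioc 0 ℓ, bumpDeriv a s x * bumpDeriv a s x = Real.pi ^ 2 / a ^ 2 * (a / 2) := by
  have h1 : ∀ x, bumpDeriv a s x * bumpDeriv a s x = indicator (Ioc s (s + a))
      (fun t => (Real.pi / a) ^ 2 * Real.cos (Real.pi / a * t - Real.pi / a * s) ^ 2) x := by
    intro x
    by_cases hx : x ∈ Ioc s (s + a)
    · simp only [bumpDeriv, indicator_of_mem hx]
      ring
    · simp only [bumpDeriv, indicator_of_notMem hx, mul_zero]
  simp only [h1]
  have hpi := Real.pi_pos
  rw [setIntegral_indicator_interval hs ha hsℓ, intervalIntegral.integral_const_mul,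
    intervalIntegral.integral_comp_mul_sub (fun x => Real.cos x ^ 2) (by positivity),
    integral_cos_sq, show Real.pi / a * (s + a) - Real.pi / a * s = Real.pi by field_simp; ring]
  simp
  field_simp

theorem integral_bumpVal_sq (ha : 0 < a) (hs : 0 ≤ s) (hsℓ : s + a ≤ ℓ) :
    ∫ x in Ioc 0 ℓ, bumpVal a s x * bumpVal a s x = a / 2 := by
  have h1 : ∀ x, bumpVal a s x * bumpVal a s x = indicator (Ioc s (s + a))
      (fun t => Real.sin (Real.pi / a * t - Real.pi / a * s) ^ 2) x := by
    intro x
    by_cases hx : x ∈ Ioc s (s + a)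
    · simp only [bumpVal, indicator_of_mem hx]
      ring
    · simp only [bumpVal, indicator_of_notMem hx, mul_zero]
  simp only [h1]
  have hpi := Real.pi_pos
  rw [setIntegral_indicator_interval hs ha hsℓ,
    intervalIntegral.integral_comp_mul_sub (fun x => Real.sin x ^ 2) (by positivity),
    integral_sin_sq, show Real.pi / a * (s + a) - Real.pi / a * s = Real.pi by field_simp; ring]
  simp
  field_simp

theorem measurable_bumpVal (a s : ℝ) : Measurable (bumpVal a s) :=
  Measurable.indicator (by fun_prop) measurableSet_Ioc

theorem abs_bumpVal_le (a s x : ℝ) : |bumpVal a s x| ≤ 1 := by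
  by_cases hx : x ∈ Ioc s (s + a)
  · rw [bumpVal, indicator_of_mem hx]
    exact Real.abs_sin_le_one _
  · rw [bumpVal, indicator_of_notMem hx]
    simp

theorem integral_bump_mul_self (ha : 0 < a) (hs : 0 ≤ s) (hsℓ : s + a ≤ ℓ) :
    ∫ x in (0 : ℝ)..ℓ, (bump ℓ a s).val x * (bump ℓ a s).val x = a / 2 := by
  rw [← integral_bumpVal_sq ha hs hsℓ, intervalIntegral.integral_of_le (by linarith)]
  refine setIntegral_congr_fun measurableSet_Ioc fun x hx => ?_
  simp only [bump_val ha hs (Ioc_subset_Icc_self hx)]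

/-- The Rayleigh quotient of a sine bump. -/
theorem energy_bump_le (ha : 0 < a) (hs : 0 ≤ s) (hsℓ : s + a ≤ ℓ) (hℓ : 0 ≤ ℓ) {q : ℝ → ℝ}
    {p : ENNReal} (hp : 1 ≤ p)
    (hq : IntervalIntegrable q volume 0 ℓ)
    (hqp : MemLp (fun x => max (q x) 0) p ((volume : Measure ℝ).restrict (Icc 0 ℓ))) :
    energy hℓ hq (bump ℓ a s) (bump ℓ a s) ≤
      ((2 / a) ^ (1 / p).toReal * (eLpNorm (fun x => max (q x) 0) p
        ((volume : Measure ℝ).restrict (Icc 0 ℓ))).toReal + Real.pi ^ 2 / a ^ 2) *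
      ∫ x in (0 : ℝ)..ℓ, (bump ℓ a s).val x * (bump ℓ a s).val x := by
  have h1 : ∫ x in Ioc 0 ℓ, (bump ℓ a s).snd x * (bump ℓ a s).snd x =
      Real.pi ^ 2 / a ^ 2 * (a / 2) := by
    rw [← integral_bumpDeriv_sq ha hs hsℓ]
    refine integral_congr_ae ((bump_snd a s).mono fun x hx => ?_)
    simp only [hx]
  -- The squared bump normalised to mass one, as its integral is `a / 2`. Its bound `2 / a` becomes
  -- the constant in Jensen's inequality.
  set w : ℝ → ℝ := fun x => 2 / a * (bumpVal a s x * bumpVal a s x) with hw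
  have hwm : Measurable w :=
    ((measurable_bumpVal a s).mul (measurable_bumpVal a s)).const_mul _
  have hw0 : ∀ x, 0 ≤ w x := fun x => mul_nonneg (by positivity) (mul_self_nonneg _)
  have hwc : ∀ x, w x ≤ 2 / a := fun x => by
    have h2 : bumpVal a s x * bumpVal a s x ≤ 1 := by
      have := abs_bumpVal_le a s x
      rw [← abs_mul_abs_self]
      nlinarith [abs_nonneg (bumpVal a s x)]
    calc w x ≤ 2 / a * 1 := mul_le_mul_of_nonneg_left h2 (by positivity)
      _ = _ := mul_one _
  have hwi : Integrable w ((volume : Measure ℝ).restrict (Icc 0 ℓ)) := by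
    refine Integrable.mono' (integrable_const (2 / a)) hwm.aestronglyMeasurable
      (Eventually.of_forall fun x => ?_)
    rw [Real.norm_eq_abs, abs_of_nonneg (hw0 x)]
    exact hwc x
  have hw1 : ∫ x in Icc 0 ℓ, w x = 1 := by
    rw [integral_Icc_eq_integral_Ioc, hw, integral_const_mul, integral_bumpVal_sq ha hs hsℓ]
    field_simp
  have h2 := integral_abs_mul_le_of_density_le hp (by positivity) hqp hwm hw0 hwc hwi hw1
  have h3 : ∫ x in (0 : ℝ)..ℓ, q x * ((bump ℓ a s).val x * (bump ℓ a s).val x) ≤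
      a / 2 * ∫ x in Icc 0 ℓ, |max (q x) 0| * w x := by
    rw [intervalIntegral.integral_of_le hℓ, ← integral_Icc_eq_integral_Ioc, ← integral_const_mul]
    have hqi : IntegrableOn q (Icc 0 ℓ) :=
      (intervalIntegrable_iff_integrableOn_Icc_of_le hℓ).1 hq
    have hi1 : IntegrableOn (fun x => q x * ((bump ℓ a s).val x * (bump ℓ a s).val x))
        (Icc 0 ℓ) := (intervalIntegrable_iff_integrableOn_Icc_of_le hℓ).1
      (intervalIntegrable_mul_val hq hℓ _ _)
    have hi2 : IntegrableOn (fun x => a / 2 * (|max (q x) 0| * w x)) (Icc 0 ℓ) := by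
      refine Integrable.const_mul (Integrable.mul_bdd (c := 2 / a) hqi.pos_part.abs
        hwm.aestronglyMeasurable (Eventually.of_forall fun x => ?_)) _
      rw [Real.norm_eq_abs, abs_of_nonneg (hw0 x)]
      exact hwc x
    refine setIntegral_mono_on hi1 hi2 measurableSet_Icc fun x hx => ?_
    rw [bump_val ha hs hx, abs_of_nonneg (le_max_right _ _)]
    calc q x * (bumpVal a s x * bumpVal a s x)
        ≤ max (q x) 0 * (bumpVal a s x * bumpVal a s x) :=
          mul_le_mul_of_nonneg_right (le_max_left _ _) (mul_self_nonneg _)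
      _ = _ := by rw [hw]; field_simp
  rw [energy_apply, h1, integral_bump_mul_self ha hs hsℓ, add_mul, add_comm]
  gcongr
  refine h3.trans ?_
  rw [mul_comm]
  gcongr

theorem bump_val_mul_bump_val (ha : 0 < a) {t : ℝ} (hs : 0 ≤ s) (hst : s + a ≤ t) {x : ℝ}
    (hx : x ∈ Icc 0 ℓ) : (bump ℓ a s).val x * (bump ℓ a t).val x = 0 := by
  rw [bump_val ha hs hx, bump_val ha (by linarith) hx]
  rcases le_total x t with h | h
  · rw [bumpVal_eq_zero_of_le h, mul_zero]
  · rw [bumpVal_eq_zero_of_ge ha (hst.trans h), zero_mul]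

theorem integral_bump_mul_bump (ha : 0 < a) {t : ℝ} (hs : 0 ≤ s) (hst : s + a ≤ t) (hℓ : 0 ≤ ℓ) :
    ∫ x in (0 : ℝ)..ℓ, (bump ℓ a s).val x * (bump ℓ a t).val x = 0 := by
  rw [intervalIntegral.integral_of_le hℓ]
  exact setIntegral_eq_zero_of_forall_eq_zero fun x hx =>
    bump_val_mul_bump_val ha hs hst (Ioc_subset_Icc_self hx)

theorem energy_bump_bump (ha : 0 < a) {t : ℝ} (hs : 0 ≤ s) (hst : s + a ≤ t) (hℓ : 0 ≤ ℓ)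
    {q : ℝ → ℝ} (hq : IntervalIntegrable q volume 0 ℓ) :
    energy hℓ hq (bump ℓ a s) (bump ℓ a t) = 0 := by
  have h1 : ∫ x in Ioc 0 ℓ, (bump ℓ a s).snd x * (bump ℓ a t).snd x = 0 := by
    refine integral_eq_zero_of_ae ?_
    filter_upwards [bump_snd (ℓ := ℓ) a s, bump_snd (ℓ := ℓ) a t] with x hx hy
    rw [hx, hy, Pi.zero_apply]
    rcases le_or_gt x t with h | h
    · rw [bumpDeriv, bumpDeriv, indicator_of_notMem (s := Ioc t (t + a))
        (fun h' => absurd h'.1 (not_lt.2 h)), mul_zero]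
    · rw [bumpDeriv, indicator_of_notMem (s := Ioc s (s + a))
        (fun h' => absurd h'.2 (not_le.2 (hst.trans_lt h))), zero_mul]
  rw [energy_apply, h1, zero_add, intervalIntegral.integral_of_le hℓ]
  refine setIntegral_eq_zero_of_forall_eq_zero fun x hx => ?_
  rw [bump_val_mul_bump_val ha hs hst (Ioc_subset_Icc_self hx), mul_zero]

end EdgeSobolev

end Bump

/-! ### Trial functions on the graph and the choice of their width. -/

namespace MetricGraph

variable {V E : Type*} (Γ : MetricGraph V E)

section Trial

theorem map_edge_le_lebesgue (e : E) :
    (volume.restrict (Icc 0 (Γ.length e))).map (Γ.edge e) ≤ Γ.lebesgue :=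
  Measure.le_sum (fun e => (volume.restrict (Icc 0 (Γ.length e))).map (Γ.edge e)) e

theorem memLp_edge {p : ENNReal} {g : Γ.Point → ℝ} (hg : MemLp g p Γ.lebesgue) (e : E) :
    MemLp (fun x => g (Γ.edge e x)) p (volume.restrict (Icc 0 (Γ.length e))) :=
  (hg.mono_measure (Γ.map_edge_le_lebesgue e)).comp_of_map (Γ.measurable_edge e).aemeasurable

theorem eLpNorm_edge_le {p : ENNReal} {g : Γ.Point → ℝ} (hg : MemLp g p Γ.lebesgue) (e : E) :
    eLpNorm (fun x => g (Γ.edge e x)) p (volume.restrict (Icc 0 (Γ.length e))) ≤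
      eLpNorm g p Γ.lebesgue := by
  have h := (hg.mono_measure (Γ.map_edge_le_lebesgue e)).1
  exact (eLpNorm_map_measure h (Γ.measurable_edge e).aemeasurable).symm.trans_le
    (eLpNorm_mono_measure g (Γ.map_edge_le_lebesgue e))

theorem intervalIntegrable_edge {p : ENNReal} (hp : 1 ≤ p) {g : Γ.Point → ℝ}
    (hg : MemLp g p Γ.lebesgue) (e : E) :
    IntervalIntegrable (fun x => g (Γ.edge e x)) volume 0 (Γ.length e) :=
  (intervalIntegrable_iff_integrableOn_Icc_of_le (Γ.length_pos e).le).2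
    ((Γ.memLp_edge hg e).integrable hp)

variable [Fintype E]

/-- A function supported on one edge and vanishing at its ends does not see the weights `β`. This is
why the final bound is independent of `α`. -/
theorem brokenForm_single [DecidableEq E] {q : E → ℝ → ℝ}
    (hq : ∀ e, IntervalIntegrable (q e) volume 0 (Γ.length e)) (β : E × Bool → ℝ)
    {e : E} {w : EdgeSobolev (Γ.length e)}
    (hw0 : w.val 0 = 0) (hwℓ : w.val (Γ.length e) = 0) (v : Γ.Broken) :
    Γ.brokenForm hq β (PiLp.single 2 e w) v =
      EdgeSobolev.energy (Γ.length_pos e).le (hq e) w (v e) := by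
  rw [brokenForm_apply, Finset.sum_eq_single e]
  · simp [Γ.endVal_single hw0 hwℓ]
  · intro e' _ he
    have : (PiLp.single 2 e w : Γ.Broken) e' = 0 := by simp [he]
    rw [this, map_zero, LinearMap.zero_apply]
  · simp

theorem inner_brokenToL2_single [DecidableEq E] {e : E} (w : EdgeSobolev (Γ.length e))
    (v : Γ.Broken) : inner ℝ (Γ.brokenToL2 (PiLp.single 2 e w)) (Γ.brokenToL2 v) =
      ∫ x in (0 : ℝ)..Γ.length e, w.val x * (v e).val x := by
  rw [← EdgeSobolev.inner_toL2 (Γ.length_pos e).le, PiLp.inner_apply, Finset.sum_eq_single e]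
  · simp [brokenToL2_apply]
  · intro e' _ he
    have : (PiLp.single 2 e w : Γ.Broken) e' = 0 := by simp [he]
    rw [brokenToL2_apply, this, map_zero, inner_zero_left]
  · simp

variable {q : Γ.Point → ℝ} {α : V → WithTop ℝ} {p : ENNReal}
  (hq : ∀ e, IntervalIntegrable (fun x => q (Γ.edge e x)) volume 0 (Γ.length e))

/-- Counting the sine bumps of width `a`. -/
theorem sum_floor_le_sum_finrank (hp : 1 ≤ p)
    (hqp : MemLp (fun x => max (q x) 0) p Γ.lebesgue) {a M : ℝ} (ha : 0 < a)
    (hM : (2 / a) ^ (1 / p).toReal * (eLpNorm (fun x => max (q x) 0) p Γ.lebesgue).toReal +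
      Real.pi ^ 2 / a ^ 2 ≤ M)
    (h : IsSemiboundedForm (V := Γ.formDomain α) (K := Γ.BrokenL2)
      (Γ.form hq (Γ.endWeight α) α) (Γ.formToL2 α)) :
    ∑ e, ⌊Γ.length e / a⌋₊ ≤ ∑ l ∈ (h.finite_setOf_le M).toFinset,
      Module.finrank ℝ (weakEigenspace (V := Γ.formDomain α) (K := Γ.BrokenL2)
        (Γ.form hq (Γ.endWeight α) α) (Γ.formToL2 α) l) := by
  classical
  have hle := fun e => (Γ.length_pos e).le
  -- The pair `(e, j)` stands for the bump on `[j a, (j + 1) a]` in the edge `e`. The floor ensures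
  -- that it fits.
  set ι := Σ e, Fin ⌊Γ.length e / a⌋₊
  have hs0 : ∀ i : ι, (0 : ℝ) ≤ i.2 * a := fun i => by positivity
  have hsℓ : ∀ i : ι, (i.2 : ℝ) * a + a ≤ Γ.length i.1 := fun i => by
    have h1 : ((i.2 : ℕ) : ℝ) + 1 ≤ ⌊Γ.length i.1 / a⌋₊ := by exact_mod_cast i.2.2
    have h2 := h1.trans (Nat.floor_le (div_nonneg (hle i.1) ha.le))
    rw [le_div_iff₀ ha] at h2
    linarith
  set w : ∀ i : ι, EdgeSobolev (Γ.length i.1) := fun i =>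
    EdgeSobolev.bump (Γ.length i.1) a (i.2 * a) with hw
  have hw0 : ∀ i, (w i).val 0 = 0 := fun i => by
    rw [hw, EdgeSobolev.bump_val ha (hs0 i) (left_mem_Icc.2 (hle i.1)),
      EdgeSobolev.bumpVal_eq_zero_of_le (hs0 i)]
  have hwℓ : ∀ i, (w i).val (Γ.length i.1) = 0 := fun i => by
    rw [hw, EdgeSobolev.bump_val ha (hs0 i) (right_mem_Icc.2 (hle i.1)),
      EdgeSobolev.bumpVal_eq_zero_of_ge ha (hsℓ i)]
  set u : ι → Γ.formDomain α := fun i => ⟨PiLp.single 2 i.1 (w i),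
    fun s t _ => by rw [Γ.endVal_single (hw0 i) (hwℓ i), Γ.endVal_single (hw0 i) (hwℓ i)],
    fun s _ => Γ.endVal_single (hw0 i) (hwℓ i) s⟩ with hu
  have hform : ∀ i v, Γ.form hq (Γ.endWeight α) α (u i) v =
      EdgeSobolev.energy (hle i.1) (hq i.1) (w i) ((v : Γ.Broken) i.1) := fun i v =>
    Γ.brokenForm_single hq _ (hw0 i) (hwℓ i) v
  have hinner : ∀ i v, inner ℝ (Γ.formToL2 α (u i)) (Γ.formToL2 α v) =
      ∫ x in (0 : ℝ)..Γ.length i.1, (w i).val x * ((v : Γ.Broken) i.1).val x := fun i v =>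
    Γ.inner_brokenToL2_single (w i) v
  have hsame : ∀ e j, ((u ⟨e, j⟩ : Γ.Broken) e) = w ⟨e, j⟩ := fun e j => by simp [hu]
  have hdiff : ∀ i j : ι, i.1 ≠ j.1 → (u j : Γ.Broken) i.1 = 0 := fun i j hij => by simp [hu, hij]
  have hlt : ∀ e (j k : Fin ⌊Γ.length e / a⌋₊), j < k → ((j : ℕ) : ℝ) * a + a ≤ (k : ℕ) * a := by
    intro e j k hjk
    have : ((j : ℕ) : ℝ) + 1 ≤ (k : ℕ) := by exact_mod_cast hjk
    nlinarith
  have horth : ∀ i j : ι, i ≠ j → Γ.form hq (Γ.endWeight α) α (u i) (u j) = 0 ∧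
      inner ℝ (Γ.formToL2 α (u i)) (Γ.formToL2 α (u j)) = 0 := by
    intro i j hij
    by_cases he : i.1 = j.1
    · obtain ⟨e, i⟩ := i
      obtain ⟨e', j⟩ := j
      obtain rfl : e = e' := he
      have hij' : i ≠ j := fun h => hij (by rw [h])
      rcases lt_or_gt_of_ne hij' with h' | h'
      · rw [hform, hinner, hsame]
        exact ⟨EdgeSobolev.energy_bump_bump ha (hs0 ⟨e, i⟩) (hlt e i j h') _ _,
          EdgeSobolev.integral_bump_mul_bump ha (hs0 ⟨e, i⟩) (hlt e i j h') (hle e)⟩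
      · rw [h.symm, real_inner_comm, hform, hinner, hsame]
        exact ⟨EdgeSobolev.energy_bump_bump ha (hs0 ⟨e, j⟩) (hlt e j i h') _ _,
          EdgeSobolev.integral_bump_mul_bump ha (hs0 ⟨e, j⟩) (hlt e j i h') (hle e)⟩
    · refine ⟨?_, ?_⟩
      · rw [hform, hdiff i j he, map_zero]
      · rw [hinner, hdiff i j he, ← EdgeSobolev.inner_toL2 (hle i.1), map_zero, inner_zero_right]
  have hcard := h.card_le_sum_finrank (M := M) u ?_ (fun i j hij => (horth i j hij).1)
    (fun i j hij => (horth i j hij).2) ?_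
  · simpa [ι] using hcard
  · intro i hi
    have h1 := hinner i (u i)
    rw [hi, map_zero, inner_zero_left] at h1
    rw [← hi, hsame, EdgeSobolev.integral_bump_mul_self ha (hs0 i) (hsℓ i)] at h1
    linarith
  · intro i
    rw [hform, hinner, hsame]
    refine (EdgeSobolev.energy_bump_le ha (hs0 i) (hsℓ i) (hle i.1) hp (hq i.1)
      (Γ.memLp_edge hqp i.1)).trans ?_
    refine mul_le_mul_of_nonneg_right (le_trans ?_ hM) ?_
    · gcongr
      · exact hqp.2.ne
      · exact Γ.eLpNorm_edge_le hqp i.1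
    · exact intervalIntegral.integral_nonneg (hle i.1) fun x _ => mul_self_nonneg _

theorem totalLength_pos [Nonempty E] : 0 < Γ.totalLength :=
  Finset.sum_pos (fun e _ => Γ.length_pos e) Finset.univ_nonempty

/-- Intervals of total length `L` contain at least `k` disjoint intervals of length
`L / (k - 1 + n)`, where `n` is the number of intervals. -/
theorem le_sum_floor [Nonempty E] (k : ℕ) :
    k ≤ ∑ e, ⌊Γ.length e / (Γ.totalLength / ((k : ℝ) - 1 + Fintype.card E))⌋₊ := by
  set A : ℝ := (k : ℝ) - 1 + Fintype.card E with hA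
  have hL := Γ.totalLength_pos
  have h1 : ∑ e, Γ.length e / (Γ.totalLength / A) = A := by
    rw [← Finset.sum_div]
    change Γ.totalLength / (Γ.totalLength / A) = A
    exact div_div_cancel₀ hL.ne'
  -- The left side is `k - 1 + n`, the right side the number of intervals plus `n`. Strictness
  -- recovers the missing `1`, as both numbers are integers.
  have h2 : ∑ e, Γ.length e / (Γ.totalLength / A) <
      ∑ e, ((⌊Γ.length e / (Γ.totalLength / A)⌋₊ : ℝ) + 1) :=
    Finset.sum_lt_sum_of_nonempty Finset.univ_nonempty fun e _ => Nat.lt_floor_add_one _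
  rw [h1, Finset.sum_add_distrib, Finset.sum_const, Finset.card_univ, nsmul_eq_mul, mul_one, hA]
    at h2
  have h3 : (k : ℝ) < ((∑ e, ⌊Γ.length e / (Γ.totalLength / A)⌋₊ : ℕ) : ℝ) + 1 := by
    push_cast
    linarith
  exact Nat.lt_add_one_iff.1 (by exact_mod_cast h3)

/-- Here `k - 1 + n ≤ k n`, because `(k - 1) (n - 1) ≥ 0`, and `n` times the minimal length is at
most the total length. The second summands on the two sides are equal. -/
theorem eigenvalue_bound_le [Nonempty E] {k : ℕ} (hk : 1 ≤ k) {t N : ℝ} (ht : 0 ≤ t)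
    (hN : 0 ≤ N) :
    (2 / (Γ.totalLength / ((k : ℝ) - 1 + Fintype.card E))) ^ t * N +
      Real.pi ^ 2 / (Γ.totalLength / ((k : ℝ) - 1 + Fintype.card E)) ^ 2 ≤
    (2 * (k : ℝ) / Γ.minLength) ^ t * N +
      Real.pi ^ 2 / Γ.totalLength ^ 2 * ((k : ℝ) - 1 + Fintype.card E) ^ 2 := by
  have hk' : (1 : ℝ) ≤ k := by exact_mod_cast hk
  have hn : (1 : ℝ) ≤ Fintype.card E := by exact_mod_cast Fintype.card_pos (α := E)
  set A : ℝ := (k : ℝ) - 1 + Fintype.card E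
  have hA0 : 0 < A := by linarith
  have hL := Γ.totalLength_pos
  have hmin : 0 < Γ.minLength :=
    (Finset.lt_inf'_iff Finset.univ_nonempty).2 fun e _ => Γ.length_pos e
  have hminL : Fintype.card E * Γ.minLength ≤ Γ.totalLength := by
    have := Finset.card_nsmul_le_sum Finset.univ Γ.length Γ.minLength
      fun e he => Finset.inf'_le _ he
    rwa [nsmul_eq_mul, Finset.card_univ] at this
  have h1 : 2 / (Γ.totalLength / A) ≤ 2 * k / Γ.minLength := by
    rw [div_div_eq_mul_div, div_le_div_iff₀ hL hmin]
    have h2 : A ≤ k * Fintype.card E := by nlinarith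
    calc 2 * A * Γ.minLength ≤ 2 * (k * Fintype.card E) * Γ.minLength := by gcongr
      _ = 2 * k * (Fintype.card E * Γ.minLength) := by ring
      _ ≤ 2 * k * Γ.totalLength := by gcongr
  have h3 : Real.pi ^ 2 / (Γ.totalLength / A) ^ 2 = Real.pi ^ 2 / Γ.totalLength ^ 2 * A ^ 2 := by
    field_simp
  rw [h3]
  gcongr

end Trial

end MetricGraph

/-! ### The main theorem. -/

theorem mainTheorem4 {V E : Type*} [Fintype E] [Nonempty E] (Γ : MetricGraph V E)
    (p : ENNReal) (hp : 1 ≤ p) (q : Γ.Point → ℝ) (hq : MemLp q p Γ.lebesgue)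
    (α : V → WithTop ℝ) :
    (∃ lam : ℕ → ℝ, Γ.IsEigenvalueSequence q α lam) ∧
    ∀ lam : ℕ → ℝ, Γ.IsEigenvalueSequence q α lam → ∀ k : ℕ, 1 ≤ k →
      lam k ≤ (2 * (k : ℝ) / Γ.minLength) ^ (1 / p).toReal
            * (eLpNorm (fun x => max (q x) 0) p Γ.lebesgue).toReal
          + Real.pi ^ 2 / Γ.totalLength ^ 2 * ((k : ℝ) - 1 + (Fintype.card E : ℝ)) ^ 2 := by
  have hqe := Γ.intervalIntegrable_edge hp hq
  have hqp : MemLp (fun x => max (q x) 0) p Γ.lebesgue := hq.pos_part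
  have h := Γ.isSemiboundedForm hqe (Γ.endWeight α) α
  have hrank := fun l => (Γ.weakEigenspaceEquiv hqe (α := α) l).finrank_eq
  -- This count serves twice: it bounds the members of any eigenvalue sequence, and, `k` being
  -- arbitrary, it shows that the total multiplicity is infinite, as the existence of such a
  -- sequence requires.
  have hcount : ∀ k : ℕ, 1 ≤ k → ∃ S : Finset ℝ,
      (∀ l ∈ S, l ≤ (2 * (k : ℝ) / Γ.minLength) ^ (1 / p).toReal
        * (eLpNorm (fun x => max (q x) 0) p Γ.lebesgue).toReal
        + Real.pi ^ 2 / Γ.totalLength ^ 2 * ((k : ℝ) - 1 + (Fintype.card E : ℝ)) ^ 2) ∧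
      k ≤ ∑ l ∈ S, Module.finrank ℝ (Γ.eigenspace q α l) := by
    intro k hk
    have hk' : (1 : ℝ) ≤ k := by exact_mod_cast hk
    have hn : (1 : ℝ) ≤ Fintype.card E := by exact_mod_cast Fintype.card_pos (α := E)
    have h1 := Γ.sum_floor_le_sum_finrank hqe hp hqp
      (div_pos Γ.totalLength_pos (by linarith : (0 : ℝ) < (k : ℝ) - 1 + Fintype.card E))
      (Γ.eigenvalue_bound_le hk ENNReal.toReal_nonneg ENNReal.toReal_nonneg) h
    refine ⟨_, fun l hl => ?_, (Γ.le_sum_floor k).trans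
      (h1.trans_eq (Finset.sum_congr rfl fun l _ => hrank l))⟩
    exact ((h.finite_setOf_le _).mem_toFinset.1 hl).1
  refine ⟨?_, fun lam hlam k hk => ?_⟩
  · obtain ⟨lam, hmono, htend, hmult⟩ := exists_sequence_of_multiplicity
      (d := fun l => Module.finrank ℝ (Γ.eigenspace q α l))
      (fun M => (h.finite_setOf_le M).subset fun l hl => ⟨hl.1, fun hbot => hl.2 (by
        rw [← hrank l, hbot, finrank_bot])⟩)
      (fun k => by
        rcases Nat.eq_zero_or_pos k with rfl | hk
        · exact ⟨∅, Nat.zero_le _⟩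
        · obtain ⟨S, -, hS⟩ := hcount k hk
          exact ⟨S, hS⟩)
    refine ⟨lam, hmono, htend, fun μ => ?_, hmult⟩
    have := h.finiteDimensional_weakEigenspace μ
    exact LinearEquiv.finiteDimensional (Γ.weakEigenspaceEquiv hqe μ)
  · obtain ⟨S, hSM, hS⟩ := hcount k hk
    exact le_of_le_sum_multiplicity hlam.le_of_le hlam.multiplicity hSM hk hS
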